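/- Let $D_x = \frac1i\frac{d}{dx}$ and let $\mathcal A = D_x^2 + ix$ be the complex Airy operator in $L^2(\mathbb R)=L^2(\mathbb R;\mathbb C)$, with domain $D(\mathcal A)=\{u\in H^2(\mathbb R) : xu\in L^2(\mathbb R)\}$. There are constants $M>0$ and $C>0$ such that for every $z\in\mathbb C$ with $\operatorname{Re} z\ge M$ the operator $\mathcal A - z : D(\mathcal A)\to L^2(\mathbb R)$ is bijective with bounded inverse, and the operator norm of its resolvent on $L^2(\mathbb R)$ satisfies $$\|(D_x^2+ix-z)^{-1}\| = \sqrt{\tfrac{\pi}{2}}\,(\operatorname{Re} z)^{-1/4}\,(1+\varepsilon_1)\,\exp\!\left(\tfrac43(\operatorname{Re} z)^{3/2}\right)+\varepsilon_2$$ for some real numbers $\varepsilon_1,\varepsilon_2$ (depending on $z$) with $|\varepsilon_1|\le C(\operatorname{Re} z)^{-3/2}$ and $|\varepsilon_2|\le C(\operatorname{Re} z)^{-1/4}$. -/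

import Mathlib

open MeasureTheory TemperedDistribution
open scoped SchwartzMap

noncomputable section

/-- The complex Hilbert space `L²(ℝ)` (Lebesgue measure). -/
abbrev L2R : Type := Lp ℂ 2 (volume : Measure ℝ)

/-- `D_x = (1/i) d/dx` on tempered distributions on `ℝ`. -/
def distD : 𝓢'(ℝ, ℂ) →L[ℂ] 𝓢'(ℝ, ℂ) := (1 / Complex.I) • derivCLM ℂ

/-- The Sobolev space `H²(ℝ)`, as a subspace of `L²(ℝ)`: `(1 + ξ²) û ∈ L²(ℝ)`. -/
def sobolevH2 : Submodule ℂ L2R where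
  carrier := {u | MemSobolev 2 2 (u : 𝓢'(ℝ, ℂ))}
  zero_mem' := by
    change MemSobolev 2 2 (Lp.toTemperedDistributionCLM ℂ volume 2 (0 : L2R))
    rw [map_zero]
    exact memSobolev_fun_zero ℝ ℂ 2 2
  add_mem' {u v} hu hv := by
    change MemSobolev 2 2 (Lp.toTemperedDistributionCLM ℂ volume 2 (u + v))
    rw [map_add]
    exact MemSobolev.add hu hv
  smul_mem' c u hu := by
    change MemSobolev 2 2 (Lp.toTemperedDistributionCLM ℂ volume 2 (c • u))
    rw [map_smul]
    exact MemSobolev.smul c hu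

theorem derivCLM_eq_lineDerivOp (T : 𝓢'(ℝ, ℂ)) :
    derivCLM ℂ T = LineDeriv.lineDerivOp (1 : ℝ) T := by
  ext φ
  rw [derivCLM_apply_apply, lineDerivOp_apply_apply]
  congr 2

/-- For `u ∈ H²(ℝ)` the distribution `D_x² u` is given by a function in `L²(ℝ)`. -/
theorem exists_L2R_eq_distD_sq (u : sobolevH2) :
    ∃ v : L2R, (v : 𝓢'(ℝ, ℂ)) = distD (distD ((u : L2R) : 𝓢'(ℝ, ℂ))) := by
  have h : MemSobolev 2 2 ((u : L2R) : 𝓢'(ℝ, ℂ)) := u.2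
  have h2 := (h.lineDerivOp (m := (1 : ℝ))).lineDerivOp (m := (1 : ℝ))
  norm_num at h2
  obtain ⟨v, hv⟩ := memSobolev_zero_iff.1 h2
  refine ⟨-v, ?_⟩
  rw [← Lp.toTemperedDistributionCLM_apply, map_neg, Lp.toTemperedDistributionCLM_apply, ← hv]
  have hI : (1 / Complex.I) * (1 / Complex.I) = -1 := by
    rw [div_mul_div_comm, Complex.I_mul_I]
    norm_num
  simp only [distD, _root_.smul_apply, map_smul, smul_smul, hI, neg_one_smul,
    derivCLM_eq_lineDerivOp]

/-- An element of `L²(ℝ)` is determined by the tempered distribution it defines. -/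
theorem L2R_ext {v w : L2R} (h : (v : 𝓢'(ℝ, ℂ)) = (w : 𝓢'(ℝ, ℂ))) : v = w :=
  LinearMap.ker_eq_bot.1 (Lp.ker_toTemperedDistributionCLM_eq_bot (F := ℂ)
    (μ := (volume : Measure ℝ)) (p := 2)) h

/-- The operator `D_x²` in `L²(ℝ)` with domain `H²(ℝ)`. -/
def opDsq : L2R →ₗ.[ℂ] L2R where
  domain := sobolevH2
  toFun :=
    { toFun := fun u => (exists_L2R_eq_distD_sq u).choose
      map_add' := fun u v => by
        apply L2R_ext
        rw [(exists_L2R_eq_distD_sq (u + v)).choose_spec, ← Lp.toTemperedDistributionCLM_apply,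
          ← Lp.toTemperedDistributionCLM_apply, Submodule.coe_add, map_add, map_add, map_add,
          map_add]
        simp only [Lp.toTemperedDistributionCLM_apply,
          (exists_L2R_eq_distD_sq u).choose_spec, (exists_L2R_eq_distD_sq v).choose_spec]
      map_smul' := fun c u => by
        apply L2R_ext
        rw [(exists_L2R_eq_distD_sq (c • u)).choose_spec, ← Lp.toTemperedDistributionCLM_apply,
          ← Lp.toTemperedDistributionCLM_apply, Submodule.coe_smul, map_smul, map_smul, map_smul,
          RingHom.id_apply, map_smul]
        simp only [Lp.toTemperedDistributionCLM_apply,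
          (exists_L2R_eq_distD_sq u).choose_spec] }

/-- Multiplication by `x` in `L²(ℝ)`, with its maximal domain `{u ∈ L²(ℝ) | x u ∈ L²(ℝ)}`. -/
def opX : L2R →ₗ.[ℂ] L2R where
  domain :=
    { carrier := {u | MemLp (fun x : ℝ => (x : ℂ) * u x) 2 volume}
      zero_mem' := by
        refine (MemLp.zero (ε := ℂ)).ae_eq ?_
        filter_upwards [Lp.coeFn_zero ℂ 2 (volume : Measure ℝ)] with x hx
        simp only [hx, Pi.zero_apply, mul_zero]
      add_mem' := fun {u v} hu hv => by
        refine (MemLp.add hu hv).ae_eq ?_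
        filter_upwards [Lp.coeFn_add u v] with x hx
        simp only [hx, Pi.add_apply, mul_add]
      smul_mem' := fun c u hu => by
        refine (MemLp.const_smul hu c).ae_eq ?_
        filter_upwards [Lp.coeFn_smul c u] with x hx
        simp only [hx, Pi.smul_apply, smul_eq_mul, mul_left_comm] }
  toFun :=
    { toFun := fun u => MemLp.toLp (fun x : ℝ => (x : ℂ) * (u : L2R) x) u.2
      map_add' := fun u v => by
        rw [← MemLp.toLp_add]
        refine MemLp.toLp_congr _ _ ?_
        filter_upwards [Lp.coeFn_add (u : L2R) (v : L2R)] with x hx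
        simp only [Submodule.coe_add, hx, Pi.add_apply, mul_add]
      map_smul' := fun c u => by
        rw [RingHom.id_apply, ← MemLp.toLp_const_smul]
        refine MemLp.toLp_congr _ _ ?_
        filter_upwards [Lp.coeFn_smul c (u : L2R)] with x hx
        simp only [Submodule.coe_smul, hx, Pi.smul_apply, smul_eq_mul, mul_left_comm] }

/-- The complex Airy operator `D_x² + i x` in `L²(ℝ)`, with domain
`{u ∈ H²(ℝ) | x u ∈ L²(ℝ)}` (a sum of partial maps is defined on the intersection of the
domains). -/
def airyOp : L2R →ₗ.[ℂ] L2R := opDsq + Complex.I • opX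

/-- `R` is the resolvent `(A - z)⁻¹` of the unbounded operator `A` at `z`: a bounded operator,
with values in the domain of `A`, that is a two-sided inverse of `A - z`. -/
def IsResolventAt {H : Type*} [NormedAddCommGroup H] [NormedSpace ℂ H]
    (A : H →ₗ.[ℂ] H) (z : ℂ) (R : H →L[ℂ] H) : Prop :=
  (∀ f : H, ∃ hf : R f ∈ A.domain, A ⟨R f, hf⟩ - z • R f = f) ∧
    ∀ u : A.domain, R (A u - z • (u : H)) = u

end

/-! On the Fourier side `D_x` becomes multiplication by `2πξ` and `ix` becomes `-(1/2π) d/dξ`, so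
the equation for `𝒜 - z` is a first-order ODE with homogeneous solution `e^Φ`, `Φ = airyPhase z`.
Since `Re Φ` is a cubic that tends to `+∞` at `+∞`, the inhomogeneous equation has the solution
`v(x) = 2π ∫_x^∞ e^{Φ(x) - Φ(y)} g(y) dy`. Schur's test shows that this is bounded on `L²`, also
with the weight `x²`, which puts the solution in the domain. As `e^Φ` is not square integrable near
`+∞`, the solution is unique (`eq_zero_of_derivCLM_eq`). Hence the resolvent exists for every `z`,
and by Plancherel its norm is that of the integral operator.

For the norm, put `a = √(Re z)` and `X = 2πx`, `Y = 2πy`. The cubic `X³/3 - a²X` has a maximum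
`2a³/3` at `-a` and a minimum `-2a³/3` at `a`, so the kernel peaks near `X = -a`, `Y = a`, in the
quadrant `x < 0 < y`. There the constraint `x < y` is automatic and the kernel is a product: a rank
one operator. Because `Φ` is odd, both factors have the same norm, and the operator norm is exactly
`∫_0^∞ exp(-2(y³/3 - a²y)) dy` (`norm_airyRankOne`). Laplace's method at `y = a` gives the main term
(`abs_integral_exp_cubic_sub_le`). Outside the quadrant only one of the two critical values can be
exploited, so the remainder has norm at most `exp(2a³/3 + 4a)`, which is absorbed in the relative
error. -/

noncomputable section

section

/-! ### Schur's test -/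

open scoped ENNReal NNReal

/-- `k` is a measurable integral kernel on `ℝ × ℝ` whose absolute row and column integrals are
bounded by `A` (the hypothesis of Schur's test). -/
structure IsSchurKernel (k : ℝ → ℝ → ℂ) (A : ℝ≥0) : Prop where
  measurable : Measurable (Function.uncurry k)
  lintegral_right_le : ∀ x, ∫⁻ y, ‖k x y‖ₑ ≤ A
  lintegral_left_le : ∀ y, ∫⁻ x, ‖k x y‖ₑ ≤ A

/-- Cauchy-Schwarz inequality with a weight. -/
theorem sq_lintegral_mul_le {κ f : ℝ → ℝ≥0∞} (hκ : Measurable κ) (hf : AEMeasurable f) :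
    (∫⁻ y, κ y * f y) ^ 2 ≤ (∫⁻ y, κ y) * ∫⁻ y, κ y * f y ^ 2 := by
  have hκ' : Measurable fun y => κ y ^ (1 / 2 : ℝ) := hκ.pow_const _
  have h := ENNReal.lintegral_mul_le_Lp_mul_Lq volume (p := 2) (q := 2)
    Real.HolderConjugate.two_two hκ'.aemeasurable (hκ'.aemeasurable.mul hf)
  have e1 : ∀ y, ((fun y => κ y ^ (1 / 2 : ℝ)) * ((fun y => κ y ^ (1 / 2 : ℝ)) * f)) y
      = κ y * f y := by
    intro y
    simp only [Pi.mul_apply, ← mul_assoc]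
    rw [← ENNReal.rpow_add_of_nonneg _ _ (by norm_num) (by norm_num)]
    norm_num
  have e2 : ∀ y, (κ y ^ (1 / 2 : ℝ)) ^ (2 : ℝ) = κ y := by
    intro y
    rw [← ENNReal.rpow_mul]
    norm_num
  have e3 : ∀ y, ((fun y => κ y ^ (1 / 2 : ℝ)) * f) y ^ (2 : ℝ) = κ y * f y ^ 2 := by
    intro y
    rw [Pi.mul_apply, ENNReal.mul_rpow_of_nonneg _ _ (by norm_num), e2, ENNReal.rpow_two]
  simp only [e1, e2, e3] at h
  calc (∫⁻ y, κ y * f y) ^ 2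
      ≤ ((∫⁻ y, κ y) ^ (1 / 2 : ℝ) * (∫⁻ y, κ y * f y ^ 2) ^ (1 / 2 : ℝ)) ^ 2 := by gcongr
    _ = _ := by
      rw [mul_pow]
      simp only [← ENNReal.rpow_two, ← ENNReal.rpow_mul]
      norm_num

namespace IsSchurKernel

variable {k : ℝ → ℝ → ℂ} {A : ℝ≥0}

/-- Schur's test: Cauchy-Schwarz in `y` with weight `‖k x y‖` uses up the row bound, and Tonelli
then uses the column bound. -/
theorem lintegral_sq_le (hk : IsSchurKernel k A) {f : ℝ → ℝ≥0∞} (hf : AEMeasurable f) :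
    ∫⁻ x, (∫⁻ y, ‖k x y‖ₑ * f y) ^ 2 ≤ A ^ 2 * ∫⁻ y, f y ^ 2 := by
  have hm : Measurable (Function.uncurry fun x y => ‖k x y‖ₑ) := hk.measurable.enorm
  calc ∫⁻ x, (∫⁻ y, ‖k x y‖ₑ * f y) ^ 2
      ≤ ∫⁻ x, A * ∫⁻ y, ‖k x y‖ₑ * f y ^ 2 := by
        refine lintegral_mono fun x => ?_
        refine (sq_lintegral_mul_le (κ := fun y => ‖k x y‖ₑ)
          (hm.comp measurable_prodMk_left) hf).trans ?_
        gcongr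
        exact hk.lintegral_right_le x
    _ = A * ∫⁻ x, ∫⁻ y, ‖k x y‖ₑ * f y ^ 2 := lintegral_const_mul' _ _ ENNReal.coe_ne_top
    _ = A * ∫⁻ y, ∫⁻ x, ‖k x y‖ₑ * f y ^ 2 := by
        rw [lintegral_lintegral_swap]
        exact hm.aemeasurable.mul ((hf.pow_const 2).comp_snd)
    _ ≤ A * ∫⁻ y, A * f y ^ 2 := by
        gcongr with y
        rw [lintegral_mul_const]
        · gcongr
          exact hk.lintegral_left_le y
        · exact hm.comp measurable_prodMk_right
    _ = _ := by rw [lintegral_const_mul' _ _ ENNReal.coe_ne_top, ← mul_assoc, sq]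

theorem aestronglyMeasurable_mul (hk : IsSchurKernel k A) {g : ℝ → ℂ}
    (hg : AEStronglyMeasurable g) :
    AEStronglyMeasurable (fun p : ℝ × ℝ => k p.1 p.2 * g p.2) (volume.prod volume) :=
  hk.measurable.aestronglyMeasurable.mul hg.comp_snd

theorem enorm_integral_le (g : ℝ → ℂ) (x : ℝ) :
    ‖∫ y, k x y * g y‖ₑ ≤ ∫⁻ y, ‖k x y‖ₑ * ‖g y‖ₑ := by
  refine (enorm_integral_le_lintegral_enorm _).trans (le_of_eq ?_)
  simp only [enorm_mul]

theorem eLpNorm_le (hk : IsSchurKernel k A) {g : ℝ → ℂ} (hg : AEStronglyMeasurable g) :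
    eLpNorm (fun x => ∫ y, k x y * g y) 2 volume ≤ A * eLpNorm g 2 volume := by
  have h2 : (2 : ℝ≥0∞).toReal = 2 := by norm_num
  rw [eLpNorm_eq_lintegral_rpow_enorm_toReal (by norm_num) (by norm_num),
    eLpNorm_eq_lintegral_rpow_enorm_toReal (by norm_num) (by norm_num), h2]
  simp only [ENNReal.rpow_two]
  calc (∫⁻ x, ‖∫ y, k x y * g y‖ₑ ^ 2) ^ (1 / 2 : ℝ)
      ≤ (A ^ 2 * ∫⁻ y, ‖g y‖ₑ ^ 2) ^ (1 / 2 : ℝ) := by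
        gcongr
        refine le_trans (lintegral_mono fun x => ?_) (hk.lintegral_sq_le hg.enorm)
        gcongr
        exact enorm_integral_le g x
    _ = _ := by
      rw [ENNReal.mul_rpow_of_nonneg _ _ (by norm_num), ← ENNReal.rpow_two, ← ENNReal.rpow_mul]
      norm_num

theorem memLp (hk : IsSchurKernel k A) {g : ℝ → ℂ} (hg : MemLp g 2 volume) :
    MemLp (fun x => ∫ y, k x y * g y) 2 volume :=
  ⟨(hk.aestronglyMeasurable_mul hg.1).integral_prod_right',
    (hk.eLpNorm_le hg.1).trans_lt (ENNReal.mul_lt_top ENNReal.coe_lt_top hg.2)⟩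

theorem ae_integrable (hk : IsSchurKernel k A) {g : ℝ → ℂ} (hg : MemLp g 2 volume) :
    ∀ᵐ x, Integrable (fun y => k x y * g y) := by
  have h1 : ∫⁻ x, (∫⁻ y, ‖k x y‖ₑ * ‖g y‖ₑ) ^ 2 < ∞ := by
    refine (hk.lintegral_sq_le hg.1.enorm).trans_lt (ENNReal.mul_lt_top (by finiteness) ?_)
    have := lintegral_rpow_enorm_lt_top_of_eLpNorm_lt_top (by norm_num) (by norm_num) hg.2
    simpa using this
  have hm : AEMeasurable fun x => (∫⁻ y, ‖k x y‖ₑ * ‖g y‖ₑ) ^ 2 := by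
    have := (hk.aestronglyMeasurable_mul hg.1).enorm.lintegral_prod_right'
    simp only [enorm_mul] at this
    exact this.pow_const 2
  filter_upwards [ae_lt_top' hm h1.ne, (hk.aestronglyMeasurable_mul hg.1).prodMk_left] with x hx hx'
  refine ⟨hx', ?_⟩
  rw [hasFiniteIntegral_iff_enorm]
  simp only [enorm_mul]
  by_contra h
  rw [not_lt, top_le_iff] at h
  simp [h] at hx

/-- The integral operator on `L²(ℝ)` with a kernel that satisfies Schur's test. -/
def toCLM (hk : IsSchurKernel k A) : L2R →L[ℂ] L2R :=
  LinearMap.mkContinuous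
    { toFun := fun g => (hk.memLp (Lp.memLp g)).toLp
      map_add' := fun f g => by
        rw [← MemLp.toLp_add]
        refine MemLp.toLp_congr _ _ ?_
        filter_upwards [hk.ae_integrable (Lp.memLp f), hk.ae_integrable (Lp.memLp g)] with x hf hg
        rw [Pi.add_apply, ← integral_add hf hg]
        refine integral_congr_ae ?_
        filter_upwards [Lp.coeFn_add f g] with y hy
        rw [hy, Pi.add_apply, mul_add]
      map_smul' := fun c f => by
        rw [RingHom.id_apply, ← MemLp.toLp_const_smul]
        refine MemLp.toLp_congr _ _ (Filter.Eventually.of_forall fun x => ?_)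
        rw [Pi.smul_apply, ← integral_smul]
        refine integral_congr_ae ?_
        filter_upwards [Lp.coeFn_smul c f] with y hy
        rw [hy, Pi.smul_apply, smul_eq_mul, smul_eq_mul, mul_left_comm] }
    A fun g => by
      change ‖(hk.memLp (Lp.memLp g)).toLp‖ ≤ _
      rw [Lp.norm_toLp, Lp.norm_def]
      refine (ENNReal.toReal_mono ?_ (hk.eLpNorm_le (Lp.aestronglyMeasurable g))).trans ?_
      · exact (ENNReal.mul_lt_top ENNReal.coe_lt_top (Lp.eLpNorm_lt_top g)).ne
      · rw [ENNReal.toReal_mul, ENNReal.coe_toReal]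

theorem coeFn_toCLM (hk : IsSchurKernel k A) (g : L2R) :
    hk.toCLM g =ᵐ[volume] fun x => ∫ y, k x y * g y :=
  (hk.memLp (Lp.memLp g)).coeFn_toLp

theorem norm_toCLM_le (hk : IsSchurKernel k A) : ‖hk.toCLM‖ ≤ A :=
  LinearMap.mkContinuous_norm_le _ A.2 _

/-- Schur's test for `‖k‖` and `‖g‖` makes `∫ ‖k x y‖ ‖g y‖ dy` an `L²` function of `x`, which pairs
with `‖θ‖`. This licenses Fubini when the kernel is transposed. -/
theorem integrable_prod (hk : IsSchurKernel k A) {g θ : ℝ → ℂ} (hg : MemLp g 2 volume)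
    (hθ : MemLp θ 2 volume) :
    Integrable (fun p : ℝ × ℝ => θ p.1 * (k p.1 p.2 * g p.2)) (volume.prod volume) := by
  have hm : AEStronglyMeasurable (fun p : ℝ × ℝ => θ p.1 * (k p.1 p.2 * g p.2))
      (volume.prod volume) := hθ.1.comp_fst.mul (hk.aestronglyMeasurable_mul hg.1)
  rw [integrable_prod_iff hm]
  constructor
  · filter_upwards [hk.ae_integrable hg] with x hx using hx.const_mul _
  · have he : ∀ z : ℂ, ‖(‖z‖ : ℂ)‖ₑ = ‖z‖ₑ := fun z => by
      rw [← ofReal_norm, ← ofReal_norm, Complex.norm_real, norm_norm]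
    have hk' : IsSchurKernel (fun x y => (‖k x y‖ : ℂ)) A :=
      ⟨Complex.measurable_ofReal.comp hk.measurable.norm,
        by simpa only [he] using hk.lintegral_right_le,
        by simpa only [he] using hk.lintegral_left_le⟩
    have h1 := hk'.memLp (g := fun y => (‖g y‖ : ℂ)) hg.norm.ofReal
    have h2 := (h1.norm.integrable_mul hθ.norm)
    refine h2.congr (Filter.Eventually.of_forall fun x => ?_)
    simp only [Pi.mul_apply, norm_mul]
    rw [integral_const_mul, mul_comm]
    congr 1
    simp only [← Complex.ofReal_mul]
    rw [integral_complex_ofReal, Complex.norm_real, Real.norm_of_nonneg]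
    exact integral_nonneg fun y => by positivity

theorem integral_mul_toCLM (hk : IsSchurKernel k A) (g : L2R) {θ : ℝ → ℂ}
    (hθ : MemLp θ 2 volume) :
    ∫ x, θ x * hk.toCLM g x = ∫ y, (∫ x, k x y * θ x) * g y := by
  calc ∫ x, θ x * hk.toCLM g x = ∫ x, ∫ y, θ x * (k x y * g y) := by
        refine integral_congr_ae ?_
        filter_upwards [hk.coeFn_toCLM g] with x hx
        rw [hx, integral_const_mul]
    _ = ∫ y, ∫ x, θ x * (k x y * g y) := integral_integral_swap (hk.integrable_prod (Lp.memLp g) hθ)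
    _ = _ := by
        congr 1 with y
        rw [← integral_mul_const]
        congr 1 with x
        ring

end IsSchurKernel

end

section

/-! ### The complex Airy operator on the Fourier side -/

open FourierTransform Real
open scoped ContDiff

theorem coe_smul (c : ℂ) (u : L2R) : ((c • u : L2R) : 𝓢'(ℝ, ℂ)) = c • (u : 𝓢'(ℝ, ℂ)) :=
  map_smul (Lp.toTemperedDistributionCLM ℂ volume 2) c u

/-- Multiplication of an `L²` function by a function of temperate growth, in the sense of
distributions, is given by an `L²` function exactly if the pointwise product is. -/
theorem smulLeftCLM_coe_eq_iff {g : ℝ → ℂ} (hg : g.HasTemperateGrowth) {u h : L2R} :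
    smulLeftCLM ℂ g (u : 𝓢'(ℝ, ℂ)) = (h : 𝓢'(ℝ, ℂ)) ↔ (fun x => g x * u x) =ᵐ[volume] h := by
  constructor
  · intro H
    have hu : LocallyIntegrable u volume := (Lp.memLp u).locallyIntegrable (by norm_num)
    have hh : LocallyIntegrable h volume := (Lp.memLp h).locallyIntegrable (by norm_num)
    refine ae_eq_of_integral_contDiff_smul_eq ?_ hh ?_
    · exact hu.continuous_mul hg.1.continuous
    · intro φ φ_smooth φ_cpt
      have h1 : HasCompactSupport (Complex.ofRealCLM ∘ φ) := φ_cpt.comp_left rfl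
      have h2 : ContDiff ℝ ∞ (Complex.ofRealCLM ∘ φ) := by fun_prop
      have := congrArg (fun T : 𝓢'(ℝ, ℂ) => T (h1.toSchwartzMap h2)) H
      simpa [hg, mul_assoc, mul_left_comm] using this
  · intro H
    ext φ
    simp only [Lp.toTemperedDistribution_apply, smulLeftCLM_apply_apply]
    refine integral_congr_ae ?_
    filter_upwards [H] with x hx
    rw [SchwartzMap.smulLeftCLM_apply_apply hg, ← hx]
    simp only [smul_eq_mul]
    ring

theorem derivCLM_coe_eq_iff {v w : L2R} :
    derivCLM ℂ (v : 𝓢'(ℝ, ℂ)) = (w : 𝓢'(ℝ, ℂ)) ↔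
      ∀ θ : 𝓢(ℝ, ℂ), ∫ x, deriv θ x * v x = -∫ x, θ x * w x := by
  constructor
  · intro H θ
    have := congrArg (fun T : 𝓢'(ℝ, ℂ) => T θ) H
    simp [integral_neg] at this
    rw [← this, neg_neg]
  · intro H
    ext θ
    simp [integral_neg, H θ]

theorem fourier_derivCLM (T : 𝓢'(ℝ, ℂ)) :
    𝓕 (derivCLM ℂ T) = (2 * π * Complex.I) • smulLeftCLM ℂ (fun x : ℝ => (x : ℂ)) (𝓕 T) := by
  rw [derivCLM_eq_lineDerivOp, TemperedDistribution.fourier_lineDerivOp_eq]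
  congr 3
  ext x
  simp

theorem derivCLM_fourier (T : 𝓢'(ℝ, ℂ)) :
    derivCLM ℂ (𝓕 T) = 𝓕 (-(2 * π * Complex.I) • smulLeftCLM ℂ (fun x : ℝ => (x : ℂ)) T) := by
  rw [derivCLM_eq_lineDerivOp, TemperedDistribution.lineDerivOp_fourier_eq]
  congr 3
  ext x
  simp

theorem hasTemperateGrowth_ofReal_sq :
    (fun x : ℝ => (x : ℂ) ^ 2).HasTemperateGrowth := by fun_prop

theorem fourier_distD_distD (T : 𝓢'(ℝ, ℂ)) :
    𝓕 (distD (distD T)) = ((2 * π) ^ 2 : ℂ) • smulLeftCLM ℂ (fun x : ℝ => (x : ℂ) ^ 2) (𝓕 T) := by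
  have hI : ((1 / Complex.I) * (1 / Complex.I) : ℂ) = -1 := by
    rw [div_mul_div_comm, Complex.I_mul_I]
    norm_num
  have h0 : (fun x : ℝ => (x : ℂ)).HasTemperateGrowth := by fun_prop
  have h1 : distD (distD T) = -derivCLM ℂ (derivCLM ℂ T) := by
    simp only [distD, _root_.smul_apply, map_smul, smul_smul, hI, neg_one_smul]
  have h2 : (fun x : ℝ => (x : ℂ)) * (fun x : ℝ => (x : ℂ)) = fun x : ℝ => (x : ℂ) ^ 2 := by
    ext x
    simp [sq]
  rw [h1, FourierTransform.fourier_neg, fourier_derivCLM, fourier_derivCLM, map_smul,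
    smulLeftCLM_smulLeftCLM_apply h0 h0, h2, smul_smul, ← neg_smul]
  congr 1
  ring_nf
  simp

theorem coe_opDsq (u : opDsq.domain) :
    ((opDsq u : L2R) : 𝓢'(ℝ, ℂ)) = distD (distD ((u : L2R) : 𝓢'(ℝ, ℂ))) :=
  (exists_L2R_eq_distD_sq u).choose_spec

theorem mem_airyOp_domain {u : L2R} :
    u ∈ airyOp.domain ↔ u ∈ opDsq.domain ∧ u ∈ opX.domain := Iff.rfl

theorem airyOp_apply (u : airyOp.domain) :
    airyOp u = opDsq ⟨u, (mem_airyOp_domain.1 u.2).1⟩ +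
      Complex.I • opX ⟨u, (mem_airyOp_domain.1 u.2).2⟩ := rfl

theorem coeFn_opX (u : opX.domain) : opX u =ᵐ[volume] fun x : ℝ => (x : ℂ) * (u : L2R) x :=
  MemLp.coeFn_toLp (f := fun x : ℝ => (x : ℂ) * (u : L2R) x) u.2

/-- An `L²` function whose Fourier transform `v` satisfies `ξ² v ∈ L²` and `v' ∈ L²` lies in the
domain of the complex Airy operator. -/
theorem exists_airyOp_fourierInv_eq {v k w : L2R} (hk : (fun x : ℝ => (x : ℂ) ^ 2 * v x) =ᵐ[volume] k)
    (hw : derivCLM ℂ (v : 𝓢'(ℝ, ℂ)) = (w : 𝓢'(ℝ, ℂ))) :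
    ∃ h : 𝓕⁻ v ∈ airyOp.domain,
      airyOp ⟨𝓕⁻ v, h⟩ = 𝓕⁻ (((2 * π) ^ 2 : ℂ) • k - (1 / (2 * π) : ℂ) • w) := by
  have hT : 𝓕 ((𝓕⁻ v : L2R) : 𝓢'(ℝ, ℂ)) = (v : 𝓢'(ℝ, ℂ)) := by
    rw [Lp.fourier_toTemperedDistribution_eq, FourierTransform.fourier_fourierInv_eq]
  have hk' := (smulLeftCLM_coe_eq_iff hasTemperateGrowth_ofReal_sq).2 hk
  have hid : (fun x : ℝ => (x : ℂ)).HasTemperateGrowth := by fun_prop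
  have h1 : 𝓕⁻ v ∈ opDsq.domain := by
    change MemSobolev 2 2 _
    rw [memSobolev_iff_exists_smulLeftCLM_fourier]
    -- Membership in `H²` asks for `(1 + ξ²) v ∈ L²`, and this product is `v + k`.
    refine ⟨v + k, ?_⟩
    rw [hT, smulLeftCLM_coe_eq_iff (by fun_prop)]
    filter_upwards [hk, Lp.coeFn_add v k] with x hx hx'
    rw [hx', Pi.add_apply, ← hx]
    simp only [div_self (two_ne_zero' ℝ), rpow_one, norm_eq_abs, sq_abs]
    push_cast
    ring
  have hX : smulLeftCLM ℂ (fun x : ℝ => (x : ℂ)) ((𝓕⁻ v : L2R) : 𝓢'(ℝ, ℂ)) =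
      (((-(2 * π * Complex.I))⁻¹ • 𝓕⁻ w : L2R) : 𝓢'(ℝ, ℂ)) := by
    have h2 := derivCLM_fourier ((𝓕⁻ v : L2R) : 𝓢'(ℝ, ℂ))
    rw [hT, hw, FourierTransform.fourier_smul] at h2
    rw [coe_smul, ← Lp.fourierInv_toTemperedDistribution_eq w, h2, FourierTransform.fourierInv_smul,
      FourierTransform.fourierInv_fourier_eq, smul_smul, inv_mul_cancel₀, one_smul]
    simp [pi_ne_zero]
  rw [smulLeftCLM_coe_eq_iff hid] at hX
  have h2 : 𝓕⁻ v ∈ opX.domain := (memLp_congr_ae hX).2 (Lp.memLp _)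
  refine ⟨⟨h1, h2⟩, ?_⟩
  rw [airyOp_apply]
  have e1 : opDsq ⟨𝓕⁻ v, h1⟩ = 𝓕⁻ (((2 * π) ^ 2 : ℂ) • k) := by
    apply L2R_ext
    rw [coe_opDsq ⟨𝓕⁻ v, h1⟩, ← Lp.fourierInv_toTemperedDistribution_eq (_ • k), coe_smul, ← hk', ← hT,
      ← fourier_distD_distD, FourierTransform.fourierInv_fourier_eq]
  have e2 : opX ⟨𝓕⁻ v, h2⟩ = (-(2 * π * Complex.I))⁻¹ • 𝓕⁻ w :=
    Lp.ext ((coeFn_opX _).trans hX)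
  rw [e1, e2, sub_eq_add_neg, FourierTransform.fourierInv_add, FourierTransform.fourierInv_neg,
    FourierTransform.fourierInv_smul _ w, smul_smul, ← neg_smul]
  congr 2
  have : (π : ℂ) ≠ 0 := by simp [pi_ne_zero]
  field_simp

/-- The Fourier transform `v` of a function in the domain of the complex Airy operator satisfies
`ξ² v ∈ L²` and `v' ∈ L²`. -/
theorem exists_fourier_airyOp_eq (u : airyOp.domain) :
    ∃ k w : L2R, (fun x : ℝ => (x : ℂ) ^ 2 * (𝓕 (u : L2R) : L2R) x) =ᵐ[volume] k ∧
      derivCLM ℂ ((𝓕 (u : L2R) : L2R) : 𝓢'(ℝ, ℂ)) = (w : 𝓢'(ℝ, ℂ)) ∧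
      𝓕 (airyOp u) = ((2 * π) ^ 2 : ℂ) • k - (1 / (2 * π) : ℂ) • w := by
  have hpi : (π : ℂ) ≠ 0 := by simp [pi_ne_zero]
  set k : L2R := ((2 * π) ^ 2 : ℂ)⁻¹ • 𝓕 (opDsq ⟨u, (mem_airyOp_domain.1 u.2).1⟩) with hk
  set w : L2R := (-(2 * π * Complex.I)) • 𝓕 (opX ⟨u, (mem_airyOp_domain.1 u.2).2⟩) with hw
  have hk' : (fun x : ℝ => (x : ℂ) ^ 2 * (𝓕 (u : L2R) : L2R) x) =ᵐ[volume] k := by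
    rw [← smulLeftCLM_coe_eq_iff hasTemperateGrowth_ofReal_sq, hk, coe_smul,
      ← Lp.fourier_toTemperedDistribution_eq, ← Lp.fourier_toTemperedDistribution_eq,
      coe_opDsq ⟨u, (mem_airyOp_domain.1 u.2).1⟩, fourier_distD_distD, smul_smul, inv_mul_cancel₀, one_smul]
    simp [pi_ne_zero]
  have hX : smulLeftCLM ℂ (fun x : ℝ => (x : ℂ)) ((u : L2R) : 𝓢'(ℝ, ℂ)) =
      ((opX ⟨u, (mem_airyOp_domain.1 u.2).2⟩ : L2R) : 𝓢'(ℝ, ℂ)) :=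
    (smulLeftCLM_coe_eq_iff (by fun_prop)).2 (coeFn_opX ⟨u, (mem_airyOp_domain.1 u.2).2⟩).symm
  refine ⟨k, w, hk', ?_, ?_⟩
  · rw [← Lp.fourier_toTemperedDistribution_eq, derivCLM_fourier, hX, hw, coe_smul,
      FourierTransform.fourier_smul, Lp.fourier_toTemperedDistribution_eq]
  · rw [airyOp_apply, FourierTransform.fourier_add, FourierTransform.fourier_smul, hk, hw, smul_smul, smul_smul,
      mul_inv_cancel₀ (by simp [pi_ne_zero]), one_smul, sub_eq_add_neg, ← neg_smul]
    congr 2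
    field_simp

end

section

/-! ### The resolvent kernel -/

open FourierTransform Real Filter Topology
open scoped ENNReal NNReal ContDiff

namespace IsSchurKernel

theorem mono {k k' : ℝ → ℝ → ℂ} {A : ℝ≥0} (hk : IsSchurKernel k A)
    (hm : Measurable (Function.uncurry k')) (h : ∀ x y, ‖k' x y‖ ≤ ‖k x y‖) :
    IsSchurKernel k' A :=
  ⟨hm, fun x => (lintegral_mono fun y => enorm_le_iff_norm_le.2 (h x y)).trans
      (hk.lintegral_right_le x),
    fun y => (lintegral_mono fun x => enorm_le_iff_norm_le.2 (h x y)).trans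
      (hk.lintegral_left_le y)⟩

/-- Each bound is `A` times an exponential density in `y - x`, of total mass one. The rate may
depend on the variable held fixed, so a weight growing with that variable costs nothing. -/
theorem of_exp_bound {k : ℝ → ℝ → ℂ} {A : ℝ≥0} (hm : Measurable (Function.uncurry k))
    {s t : ℝ → ℝ} (hs : ∀ x, 0 < s x) (ht : ∀ y, 0 < t y) (h0 : ∀ x y, y ≤ x → k x y = 0)
    (h1 : ∀ x y, x < y → ‖k x y‖ ≤ A * (s x * exp (-(s x * (y - x)))))
    (h2 : ∀ x y, x < y → ‖k x y‖ ≤ A * (t y * exp (-(t y * (y - x))))) :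
    IsSchurKernel k A := by
  have key : ∀ r x y : ℝ, (x < y → ‖k x y‖ ≤ A * (r * exp (-(r * (y - x))))) →
      ‖k x y‖ₑ ≤ A * ProbabilityTheory.exponentialPDF r (y - x) := by
    intro r x y h
    rcases lt_or_ge x y with hxy | hxy
    · rw [ProbabilityTheory.exponentialPDF_of_nonneg (by linarith), ← ofReal_norm,
        ← ENNReal.ofReal_coe_nnreal, ← ENNReal.ofReal_mul A.coe_nonneg]
      exact ENNReal.ofReal_le_ofReal (h hxy)
    · simp [h0 x y hxy]
  refine ⟨hm, fun x => ?_, fun y => ?_⟩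
  · calc ∫⁻ y, ‖k x y‖ₑ ≤ ∫⁻ y, A * ProbabilityTheory.exponentialPDF (s x) (y - x) :=
          lintegral_mono fun y => key _ _ _ (h1 x y)
      _ = A := by
        rw [lintegral_const_mul' _ _ ENNReal.coe_ne_top, lintegral_sub_right_eq_self
          (fun u => ProbabilityTheory.exponentialPDF (s x) u),
          ProbabilityTheory.lintegral_exponentialPDF_eq_one (hs x), mul_one]
  · calc ∫⁻ x, ‖k x y‖ₑ ≤ ∫⁻ x, A * ProbabilityTheory.exponentialPDF (t y) (y - x) :=
          lintegral_mono fun x => key _ _ _ (h2 x y)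
      _ = A := by
        rw [lintegral_const_mul' _ _ ENNReal.coe_ne_top, lintegral_sub_left_eq_self
          (fun u => ProbabilityTheory.exponentialPDF (t y) u),
          ProbabilityTheory.lintegral_exponentialPDF_eq_one (ht y), mul_one]

end IsSchurKernel

/-- The phase `Φ(ξ) = (2πξ)³/3 - z (2πξ)`; `e^Φ` spans the solutions of the Fourier transform of
`(D_x² + ix - z) u = 0`. -/
def airyPhase (z : ℂ) (x : ℝ) : ℂ := (2 * π * x : ℂ) ^ 3 / 3 - z * (2 * π * x)

theorem airyPhase_re (z : ℂ) (x : ℝ) :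
    (airyPhase z x).re = (2 * π * x) ^ 3 / 3 - z.re * (2 * π * x) := by
  have : airyPhase z x = (((2 * π * x) ^ 3 / 3 : ℝ) : ℂ) - z * ((2 * π * x : ℝ) : ℂ) := by
    simp [airyPhase]
  rw [this, Complex.sub_re, Complex.re_mul_ofReal, Complex.ofReal_re]

theorem hasDerivAt_airyPhase (z : ℂ) (x : ℝ) :
    HasDerivAt (airyPhase z) (2 * π * ((2 * π * x : ℂ) ^ 2 - z)) x := by
  have h1 : HasDerivAt (fun x : ℝ => (2 * π * x : ℂ)) (2 * π) x := by
    simpa using (Complex.ofRealCLM.hasDerivAt (x := x)).const_mul (2 * π : ℂ)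
  have h2 := ((h1.pow 3).div_const 3).sub (h1.const_mul z)
  refine h2.congr_deriv ?_
  push_cast
  ring

theorem contDiff_airyPhase (z : ℂ) : ContDiff ℝ ∞ (airyPhase z) := by
  have : ContDiff ℝ ∞ (fun x : ℝ => (x : ℂ)) := Complex.ofRealCLM.contDiff
  unfold airyPhase
  fun_prop

theorem continuous_airyPhase (z : ℂ) : Continuous (airyPhase z) := (contDiff_airyPhase z).continuous

/-- The integral kernel of the Fourier transform of `(D_x² + ix - z)⁻¹`. -/
def airyKernel (z : ℂ) (x y : ℝ) : ℂ :=
  if x < y then 2 * π * Complex.exp (airyPhase z x - airyPhase z y) else 0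

theorem measurable_airyKernel (z : ℂ) : Measurable (Function.uncurry (airyKernel z)) := by
  refine Measurable.ite (measurableSet_lt measurable_fst measurable_snd) ?_ measurable_const
  have := continuous_airyPhase z
  exact Continuous.measurable (by fun_prop)

theorem airyKernel_of_le (z : ℂ) {x y : ℝ} (h : y ≤ x) : airyKernel z x y = 0 :=
  if_neg h.not_gt

theorem airyKernel_of_lt (z : ℂ) {x y : ℝ} (h : x < y) :
    airyKernel z x y = 2 * π * Complex.exp (airyPhase z x - airyPhase z y) :=
  if_pos h

theorem norm_airyKernel_of_lt (z : ℂ) {x y : ℝ} (h : x < y) :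
    ‖airyKernel z x y‖ = 2 * π * exp ((2 * π * x) ^ 3 / 3 - z.re * (2 * π * x) -
      ((2 * π * y) ^ 3 / 3 - z.re * (2 * π * y))) := by
  rw [airyKernel_of_lt z h, norm_mul, Complex.norm_exp, Complex.sub_re, airyPhase_re, airyPhase_re]
  simp [abs_of_pos pi_pos]

/-- In `X³ - Y³ = -(Y - X)(X² + XY + Y²)` the quadratic form is positive definite, so it controls
both the squared distance and the square of either endpoint. -/
theorem norm_airyKernel_le (z : ℂ) {x y : ℝ} (h : x < y) {w : ℝ} (hw : w = x ∨ w = y) :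
    ‖airyKernel z x y‖ ≤
      2 * π * exp (2 * π * z.re * (y - x) - (y - x) ^ 3 / 3 - (y - x) * w ^ 2) := by
  rw [norm_airyKernel_of_lt z h]
  gcongr 2 * π * exp ?_
  have hp : (8 : ℝ) ≤ (2 * π) ^ 3 := by
    have := pow_le_pow_left₀ (by norm_num) (show (2 : ℝ) ≤ 2 * π by linarith [two_le_pi]) 3
    linarith
  have hd : 0 < y - x := by linarith
  -- For `w = x` the difference of the sides is `(7y + 5x)²/21 + x²/7`; the other case is symmetric.
  have hQ : (y - x) ^ 2 / 3 + w ^ 2 ≤ 8 / 3 * (x ^ 2 + x * y + y ^ 2) := by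
    rcases hw with rfl | rfl
    · nlinarith [sq_nonneg (7 * y + 5 * w), sq_nonneg w]
    · nlinarith [sq_nonneg (7 * x + 5 * w), sq_nonneg w]
  have hQ0 : 0 ≤ x ^ 2 + x * y + y ^ 2 := by nlinarith [sq_nonneg (x + y), sq_nonneg x, sq_nonneg y]
  have h1 : (y - x) * ((y - x) ^ 2 / 3 + w ^ 2) ≤
      (y - x) * ((2 * π) ^ 3 / 3 * (x ^ 2 + x * y + y ^ 2)) := by
    refine mul_le_mul_of_nonneg_left (hQ.trans ?_) hd.le
    gcongr
  nlinarith [h1]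

/-- The cubic beats any linear term. The factor `1 + d²` is kept to move a weight from `x` to `y`,
and `exp (-d)` to raise the decay rate from `w²` to `1 + w²`. -/
theorem exists_growth_bound (l : ℝ) : ∃ C : ℝ≥0, ∀ d : ℝ, 0 < d →
    (1 + d ^ 2) * (2 * π * exp (l * d - d ^ 3 / 3)) ≤ C * exp (-d) := by
  -- Of the two extra units, one pays for `1 + d² ≤ 2 e^d` and one leaves the factor `e^{-d}`.
  set m : ℝ := |l| + 2 with hm
  have hm0 : 0 < m := by positivity
  refine ⟨Real.toNNReal (4 * π * exp (m * (3 * m + 1))), fun d hd => ?_⟩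
  have h1 : 1 + d ^ 2 ≤ 2 * exp d := by
    have := quadratic_le_exp_of_nonneg hd.le
    linarith
  have h2 : m * d - d ^ 3 / 3 ≤ m * (3 * m + 1) := by
    rcases le_or_gt d (3 * m + 1) with h | h
    · have := mul_le_mul_of_nonneg_left h hm0.le
      have := pow_pos hd 3
      linarith
    · have h3 : 3 * m ≤ d ^ 2 := by nlinarith
      have := mul_le_mul_of_nonneg_right h3 hd.le
      have : 0 ≤ m * (3 * m + 1) := by positivity
      nlinarith
  have h3 : l * d ≤ |l| * d := mul_le_mul_of_nonneg_right (le_abs_self l) hd.le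
  calc (1 + d ^ 2) * (2 * π * exp (l * d - d ^ 3 / 3))
      ≤ (2 * exp d) * (2 * π * exp (l * d - d ^ 3 / 3)) := by gcongr
    _ = 4 * π * exp (d + (l * d - d ^ 3 / 3)) := by rw [exp_add]; ring
    _ ≤ 4 * π * exp (m * (3 * m + 1) + -d) := by
        gcongr 4 * π * exp ?_
        rw [hm] at h2 ⊢
        linarith
    _ = _ := by
        rw [exp_add, Real.coe_toNNReal _ (by positivity)]
        ring

/-- The kernel decays in `y - x` at rate `1 + w²` for either endpoint `w`, so one integration gains
`1/(1 + w²)` and cancels the weight. -/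
theorem exists_isSchurKernel_airyKernel (z : ℂ) : ∃ A : ℝ≥0,
    IsSchurKernel (fun x y => (1 + (x : ℂ) ^ 2) * airyKernel z x y) A := by
  obtain ⟨C, hC⟩ := exists_growth_bound (2 * π * z.re)
  have hb : ∀ x y w : ℝ, x < y → (w = x ∨ w = y) →
      (1 + (y - x) ^ 2) * ‖airyKernel z x y‖ ≤ C * exp (-((1 + w ^ 2) * (y - x))) := by
    intro x y w h hw
    calc (1 + (y - x) ^ 2) * ‖airyKernel z x y‖
        ≤ (1 + (y - x) ^ 2) * (2 * π *
          exp (2 * π * z.re * (y - x) - (y - x) ^ 3 / 3 - (y - x) * w ^ 2)) := by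
          gcongr
          exact norm_airyKernel_le z h hw
      _ = (1 + (y - x) ^ 2) * (2 * π * exp (2 * π * z.re * (y - x) - (y - x) ^ 3 / 3)) *
          exp (-((y - x) * w ^ 2)) := by
          rw [sub_eq_add_neg _ ((y - x) * w ^ 2), exp_add]
          ring
      _ ≤ C * exp (-(y - x)) * exp (-((y - x) * w ^ 2)) := by
          gcongr ?_ * _
          exact hC _ (sub_pos.2 h)
      _ = _ := by
          rw [mul_assoc, ← exp_add]
          ring_nf
  have hn : ∀ x : ℝ, ‖(1 + (x : ℂ) ^ 2)‖ = 1 + x ^ 2 := by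
    intro x
    rw [← Complex.ofReal_one, ← Complex.ofReal_pow, ← Complex.ofReal_add, Complex.norm_real,
      norm_of_nonneg (by positivity)]
  refine ⟨2 * C, IsSchurKernel.of_exp_bound (s := fun x => 1 + x ^ 2) (t := fun y => 1 + y ^ 2)
    ?_ (fun x => by positivity) (fun x => by positivity) ?_ ?_ ?_⟩
  · refine Measurable.mul ?_ (measurable_airyKernel z)
    exact Continuous.measurable (by fun_prop)
  · intro x y h
    rw [airyKernel_of_le z h, mul_zero]
  · intro x y h
    rw [norm_mul, hn]
    push_cast
    have h1 := hb x y x h (Or.inl rfl)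
    have h2 : ‖airyKernel z x y‖ ≤ (1 + (y - x) ^ 2) * ‖airyKernel z x y‖ :=
      le_mul_of_one_le_left (norm_nonneg _) (by nlinarith [sq_nonneg (y - x)])
    have h3 := mul_le_mul_of_nonneg_left (h2.trans h1) (show 0 ≤ 1 + x ^ 2 by positivity)
    have h4 : 0 ≤ (1 + x ^ 2) * (C * exp (-((1 + x ^ 2) * (y - x)))) := by positivity
    linarith
  · intro x y h
    rw [norm_mul, hn]
    push_cast
    have h1 := hb x y y h (Or.inr rfl)
    -- The weight sits at `x` but the column integral fixes `y`; the loss in moving it is polynomial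
    -- in `y - x`.
    have h2 : 1 + x ^ 2 ≤ 2 * (1 + y ^ 2) * (1 + (y - x) ^ 2) := by
      nlinarith [sq_nonneg (y + (y - x)), sq_nonneg (y * (y - x)), sq_nonneg (y - x), sq_nonneg y]
    calc (1 + x ^ 2) * ‖airyKernel z x y‖
        ≤ 2 * (1 + y ^ 2) * (1 + (y - x) ^ 2) * ‖airyKernel z x y‖ := by gcongr
      _ = 2 * (1 + y ^ 2) * ((1 + (y - x) ^ 2) * ‖airyKernel z x y‖) := by ring
      _ ≤ 2 * (1 + y ^ 2) * (C * exp (-((1 + y ^ 2) * (y - x)))) := by gcongr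
      _ = _ := by ring

/-- Needed against Schwartz functions: it gives integrability and kills the boundary term at `-∞`.
-/
theorem exists_norm_airyKernel_le (z : ℂ) : ∃ C : ℝ≥0, ∀ x y, ‖airyKernel z x y‖ ≤ C := by
  obtain ⟨C, hC⟩ := exists_growth_bound (2 * π * z.re)
  refine ⟨C, fun x y => ?_⟩
  rcases lt_or_ge x y with h | h
  · have hd : 0 < y - x := by linarith
    refine (norm_airyKernel_le z h (Or.inl rfl)).trans ?_
    have h1 : exp (2 * π * z.re * (y - x) - (y - x) ^ 3 / 3 - (y - x) * x ^ 2) ≤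
        exp (2 * π * z.re * (y - x) - (y - x) ^ 3 / 3) :=
      exp_le_exp.2 (by nlinarith [mul_nonneg hd.le (sq_nonneg x)])
    have h2 : exp (-(y - x)) ≤ 1 := exp_le_one_iff.2 (by linarith)
    have h3 := hC _ hd
    have h4 : (C : ℝ) * exp (-(y - x)) ≤ C * 1 := by gcongr
    have h5 : 0 ≤ (y - x) ^ 2 * (2 * π * exp (2 * π * z.re * (y - x) - (y - x) ^ 3 / 3)) := by
      positivity
    have h6 : 2 * π * exp (2 * π * z.re * (y - x) - (y - x) ^ 3 / 3 - (y - x) * x ^ 2) ≤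
      2 * π * exp (2 * π * z.re * (y - x) - (y - x) ^ 3 / 3) := by gcongr
    linarith
  · rw [airyKernel_of_le z h, norm_zero]
    exact C.2

/-- A Schur bound for the kernel `airyKernel z`, also with the weight `1 + x²`. -/
def airyBound (z : ℂ) : ℝ≥0 := (exists_isSchurKernel_airyKernel z).choose

theorem isSchurKernel_airyKernel (z : ℂ) : IsSchurKernel (airyKernel z) (airyBound z) := by
  refine (exists_isSchurKernel_airyKernel z).choose_spec.mono (measurable_airyKernel z)
    fun x y => ?_
  rw [norm_mul]
  refine le_mul_of_one_le_left (norm_nonneg _) ?_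
  rw [← Complex.ofReal_one, ← Complex.ofReal_pow, ← Complex.ofReal_add, Complex.norm_real,
      norm_of_nonneg (by positivity)]
  nlinarith [sq_nonneg x]

theorem isSchurKernel_sq_mul_airyKernel (z : ℂ) :
    IsSchurKernel (fun x y => (x : ℂ) ^ 2 * airyKernel z x y) (airyBound z) := by
  refine (exists_isSchurKernel_airyKernel z).choose_spec.mono ?_ fun x y => ?_
  · refine Measurable.mul ?_ (measurable_airyKernel z)
    exact Continuous.measurable (by fun_prop)
  · rw [norm_mul, norm_mul]
    gcongr
    rw [← Complex.ofReal_one, ← Complex.ofReal_pow, ← Complex.ofReal_add, Complex.norm_real,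
      Complex.norm_real, norm_of_nonneg (by positivity), norm_of_nonneg (by positivity)]
    linarith

/-- The Fourier transform of `(D_x² + ix - z)⁻¹`. -/
def airyFourierResolvent (z : ℂ) : L2R →L[ℂ] L2R := (isSchurKernel_airyKernel z).toCLM

theorem sq_mul_airyFourierResolvent (z : ℂ) (g : L2R) :
    (fun x : ℝ => (x : ℂ) ^ 2 * airyFourierResolvent z g x) =ᵐ[volume]
      (isSchurKernel_sq_mul_airyKernel z).toCLM g := by
  filter_upwards [(isSchurKernel_airyKernel z).coeFn_toCLM g,
    (isSchurKernel_sq_mul_airyKernel z).coeFn_toCLM g] with x h1 h2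
  rw [airyFourierResolvent, h1, h2, ← integral_const_mul]
  simp only [mul_assoc]

/-- With `θ' + Φ'θ` in place of `θ`, the integrand on `(-∞, y)` is the exact derivative of `2π
e^{Φ(x) - Φ(y)} θ(x)`, so only the boundary value at `y` survives. In weak form, the kernel is a
fundamental solution. -/
theorem integral_airyKernel_mul (z : ℂ) (θ θ' : 𝓢(ℝ, ℂ))
    (hθ : ∀ x, θ' x = deriv θ x + 2 * π * ((2 * π * x : ℂ) ^ 2 - z) * θ x) (y : ℝ) :
    ∫ x, airyKernel z x y * θ' x = 2 * π * θ y := by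
  obtain ⟨C, hC⟩ := exists_norm_airyKernel_le z
  have hint : Integrable (fun x => airyKernel z x y * θ' x) := by
    refine θ'.integrable.bdd_mul (c := C) ?_ (Eventually.of_forall fun x => hC x y)
    exact ((measurable_airyKernel z).comp measurable_prodMk_right).aestronglyMeasurable
  have hind : (fun x => airyKernel z x y * θ' x) = (Set.Iio y).indicator
      (fun x => 2 * π * Complex.exp (airyPhase z x - airyPhase z y) * θ' x) := by
    ext x
    by_cases h : x < y
    · rw [Set.indicator_of_mem (Set.mem_Iio.2 h), airyKernel_of_lt z h]
    · rw [Set.indicator_of_notMem (mt Set.mem_Iio.1 h), airyKernel_of_le z (not_lt.1 h), zero_mul]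
  have hderiv : ∀ x, HasDerivAt
      (fun x => 2 * π * Complex.exp (airyPhase z x - airyPhase z y) * θ x)
      (2 * π * Complex.exp (airyPhase z x - airyPhase z y) * θ' x) x := by
    intro x
    have h1 := (((hasDerivAt_airyPhase z x).sub_const (airyPhase z y)).cexp.const_mul
      (2 * π : ℂ)).mul (θ.differentiableAt (x := x)).hasDerivAt
    refine h1.congr_deriv ?_
    rw [hθ]
    ring
  have htend : Tendsto (fun x => 2 * π * Complex.exp (airyPhase z x - airyPhase z y) * θ x)
      atBot (𝓝 0) := by
    have h1 : Tendsto (fun x => C * ‖θ x‖) atBot (𝓝 0) := by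
      have := (θ.tendsto_cocompact.mono_left _root_.atBot_le_cocompact).norm.const_mul (C : ℝ)
      simpa using this
    refine squeeze_zero_norm' ?_ h1
    filter_upwards [eventually_lt_atBot y] with x hx
    rw [norm_mul, ← airyKernel_of_lt z hx]
    gcongr
    exact hC x y
  rw [hind, integrable_indicator_iff measurableSet_Iio] at hint
  rw [hind, integral_indicator measurableSet_Iio, ← integral_Iic_eq_integral_Iio,
    integral_Iic_of_hasDerivAt_of_tendsto (hderiv y).continuousAt.continuousWithinAt
      (fun x _ => hderiv x) ((integrableOn_Iic_iff_integrableOn_Iio).2 hint) htend]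
  simp

theorem integrable_schwartz_mul (θ : 𝓢(ℝ, ℂ)) (v : L2R) : Integrable (fun x => θ x * v x) :=
  (θ.memLp 2).integrable_mul (Lp.memLp v)

/-- The differential equation satisfied by `airyFourierResolvent z g`. -/
theorem derivCLM_airyFourierResolvent (z : ℂ) (g : L2R) :
    derivCLM ℂ (airyFourierResolvent z g : 𝓢'(ℝ, ℂ)) =
      (((2 * π : ℂ) • (((2 * π) ^ 2 : ℂ) • (isSchurKernel_sq_mul_airyKernel z).toCLM g -
        z • airyFourierResolvent z g - g) : L2R) : 𝓢'(ℝ, ℂ)) := by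
  rw [derivCLM_coe_eq_iff]
  intro θ
  set v := airyFourierResolvent z g with hv
  have hG : (fun x : ℝ => (2 * π * ((2 * π * x : ℂ) ^ 2 - z))).HasTemperateGrowth := by fun_prop
  set θ₂ : 𝓢(ℝ, ℂ) := SchwartzMap.smulLeftCLM ℂ (fun x : ℝ => (2 * π * ((2 * π * x : ℂ) ^ 2 - z))) θ
    with hθ₂
  have hθ₂' : ∀ x, θ₂ x = 2 * π * ((2 * π * x : ℂ) ^ 2 - z) * θ x := fun x => by
    rw [hθ₂, SchwartzMap.smulLeftCLM_apply_apply hG, smul_eq_mul]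
  set θ₁ : 𝓢(ℝ, ℂ) := SchwartzMap.derivCLM ℂ ℂ θ with hθ₁
  have hθ₁' : ∀ x, θ₁ x = deriv θ x := fun x => by rw [hθ₁, SchwartzMap.derivCLM_apply]
  have h1 : ∫ x, (θ₁ + θ₂) x * v x = ∫ y, 2 * π * θ y * g y := by
    rw [hv, airyFourierResolvent, IsSchurKernel.integral_mul_toCLM _ _ ((θ₁ + θ₂).memLp 2)]
    congr 1 with y
    rw [integral_airyKernel_mul z θ (θ₁ + θ₂) fun x => by
      rw [add_apply, hθ₁', hθ₂']]
  have h2 : ∫ x, θ x * ((2 * π : ℂ) • (((2 * π) ^ 2 : ℂ) •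
      (isSchurKernel_sq_mul_airyKernel z).toCLM g - z • v - g) : L2R) x =
      ∫ x, (θ₂ x * v x - 2 * π * θ x * g x) := by
    refine integral_congr_ae ?_
    filter_upwards [Lp.coeFn_smul (2 * π : ℂ) (((2 * π) ^ 2 : ℂ) •
      (isSchurKernel_sq_mul_airyKernel z).toCLM g - z • v - g),
      Lp.coeFn_sub (((2 * π) ^ 2 : ℂ) • (isSchurKernel_sq_mul_airyKernel z).toCLM g - z • v) g,
      Lp.coeFn_sub (((2 * π) ^ 2 : ℂ) • (isSchurKernel_sq_mul_airyKernel z).toCLM g) (z • v),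
      Lp.coeFn_smul ((2 * π) ^ 2 : ℂ) ((isSchurKernel_sq_mul_airyKernel z).toCLM g),
      Lp.coeFn_smul z v, sq_mul_airyFourierResolvent z g] with x e1 e2 e3 e4 e5 e6
    rw [e1, Pi.smul_apply, e2, Pi.sub_apply, e3, Pi.sub_apply, e4, e5, Pi.smul_apply, Pi.smul_apply,
      ← e6, hθ₂']
    simp only [smul_eq_mul]
    ring
  have i1 := integrable_schwartz_mul θ₁ v
  have i2 := integrable_schwartz_mul θ₂ v
  have i3 : Integrable (fun x => 2 * π * θ x * g x) := by
    simpa only [mul_assoc] using (integrable_schwartz_mul θ g).const_mul (2 * π : ℂ)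
  rw [h2, integral_sub i2 i3, ← h1]
  simp only [add_apply, add_mul]
  rw [integral_add i1 i2]
  simp only [hθ₁']
  ring

end

section

/-! ### Uniqueness for the homogeneous equation -/

open Real Filter Topology
open scoped ENNReal NNReal ContDiff

theorem norm_exp_neg_airyPhase (z : ℂ) (x : ℝ) :
    ‖Complex.exp (-airyPhase z x)‖ = exp (-((2 * π * x) ^ 3 / 3 - z.re * (2 * π * x))) := by
  rw [Complex.norm_exp, Complex.neg_re, airyPhase_re]

theorem integrableOn_exp_neg_airyPhase_sq (z : ℂ) (c : ℝ) :
    IntegrableOn (fun x => ‖Complex.exp (-airyPhase z x)‖ ^ 2) (Set.Ioi c) := by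
  refine integrable_of_isBigO_exp_neg one_pos ?_ ?_
  · have := continuous_airyPhase z
    exact Continuous.continuousOn (by fun_prop)
  · refine Asymptotics.IsBigO.of_bound 1 ?_
    filter_upwards [eventually_ge_atTop (|z.re| + 1)] with x hx
    rw [norm_exp_neg_airyPhase, ← exp_nat_mul, one_mul, norm_eq_abs, norm_eq_abs, abs_exp, abs_exp,
      exp_le_exp]
    have hx0 : 0 ≤ |z.re| := abs_nonneg _
    have hy : 4 * x ≤ 2 * π * x := by nlinarith [two_le_pi]
    set y := 2 * π * x
    have h1 : z.re * y ≤ |z.re| * y := mul_le_mul_of_nonneg_right (le_abs_self _) (by linarith)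
    have h2 : |z.re| + 1 ≤ y ^ 2 / 3 := by nlinarith
    have h3 := mul_le_mul_of_nonneg_right h2 (show 0 ≤ y by linarith)
    push_cast
    nlinarith

theorem memLp_exp_neg_airyPhase (z : ℂ) (c : ℝ) :
    MemLp ((Set.Ioi c).indicator fun x => Complex.exp (-airyPhase z x)) 2 volume := by
  rw [memLp_indicator_iff_restrict measurableSet_Ioi]
  have := continuous_airyPhase z
  rw [memLp_two_iff_integrable_sq_norm (Continuous.aestronglyMeasurable (by fun_prop))]
  exact integrableOn_exp_neg_airyPhase_sq z c

/-- `e^{-Φ}` is an integrating factor: testing the equation against `e^{-Φ} χ` shows that `e^{-Φ} v`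
has zero weak derivative. -/
theorem integral_exp_neg_airyPhase_mul_deriv_eq_zero {z : ℂ} {v w : L2R}
    (hw : w =ᵐ[volume] fun x : ℝ => 2 * π * ((2 * π * x : ℂ) ^ 2 - z) * v x)
    (h : derivCLM ℂ (v : 𝓢'(ℝ, ℂ)) = (w : 𝓢'(ℝ, ℂ))) {χ : ℝ → ℂ} (hχ : ContDiff ℝ ∞ χ)
    (hc : HasCompactSupport χ) :
    ∫ x, Complex.exp (-airyPhase z x) * deriv χ x * v x = 0 := by
  have hΦ := contDiff_airyPhase z
  have hE : ContDiff ℝ ∞ fun x => Complex.exp (-airyPhase z x) := hΦ.neg.cexp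
  set θ : 𝓢(ℝ, ℂ) := HasCompactSupport.toSchwartzMap
    (f := fun x => Complex.exp (-airyPhase z x) * χ x) hc.mul_left (hE.mul hχ) with hθ
  set η : 𝓢(ℝ, ℂ) := HasCompactSupport.toSchwartzMap
    (f := fun x => Complex.exp (-airyPhase z x) * deriv χ x) hc.deriv.mul_left
    (hE.mul (contDiff_infty_iff_deriv.1 hχ).2) with hη
  have hd : ∀ x, deriv θ x = η x - 2 * π * ((2 * π * x : ℂ) ^ 2 - z) * θ x := by
    intro x
    have h1 := (hasDerivAt_airyPhase z x).neg.cexp.mul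
      (hχ.differentiable (by simp) x).hasDerivAt
    have h2 : deriv θ x = _ := h1.deriv
    rw [h2]
    simp only [hη, hθ, HasCompactSupport.toSchwartzMap_toFun, Pi.neg_apply]
    ring
  have h1 := (derivCLM_coe_eq_iff.1 h) θ
  have h2 : ∫ x, deriv θ x * v x = ∫ x, (η x * v x - θ x * w x) := by
    refine integral_congr_ae ?_
    filter_upwards [hw] with x hx
    rw [hd, hx]
    ring
  rw [h2, integral_sub (integrable_schwartz_mul η v) (integrable_schwartz_mul θ w), sub_eq_neg_self]
    at h1
  exact h1

/-- The equation `v' = Φ' v` has no nonzero solution in `L²(ℝ)`. -/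
theorem eq_zero_of_derivCLM_eq {z : ℂ} {v w : L2R}
    (hw : w =ᵐ[volume] fun x : ℝ => 2 * π * ((2 * π * x : ℂ) ^ 2 - z) * v x)
    (h : derivCLM ℂ (v : 𝓢'(ℝ, ℂ)) = (w : 𝓢'(ℝ, ℂ))) : v = 0 := by
  have hcE : Continuous fun x => Complex.exp (-airyPhase z x) := by
    have := continuous_airyPhase z
    fun_prop
  have hv : LocallyIntegrable v volume := (Lp.memLp v).locallyIntegrable (by norm_num)
  suffices h0 : ∀ᵐ x, Complex.exp (-airyPhase z x) * v x = 0 by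
    rw [Lp.eq_zero_iff_ae_eq_zero]
    filter_upwards [h0] with x hx
    simpa using hx
  refine ae_eq_zero_of_integral_contDiff_smul_eq_zero (hv.continuous_mul hcE) fun ψ hψ hψc => ?_
  obtain ⟨B, hB0, hB⟩ : ∃ B : ℝ, 0 < B ∧ ∀ x, B ≤ |x| → ψ x = 0 := by
    obtain ⟨B, hB⟩ := hψc.isCompact.isBounded.subset_ball_lt 0 0
    refine ⟨B, hB.1, fun x hx => ?_⟩
    by_contra hne
    have := hB.2 (subset_tsupport ψ hne)
    rw [mem_ball_zero_iff, norm_eq_abs] at this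
    linarith
  -- This primitive of `ψ` vanishes to the left of the support, where `e^{-Φ}` is large. On the
  -- right it is eventually a constant, possibly nonzero, and has to be cut off.
  set Ψ : ℝ → ℝ := fun x => ∫ t in (-B)..x, ψ t with hΨ
  have hΨd : ∀ x, HasDerivAt Ψ (ψ x) x := fun x =>
    intervalIntegral.integral_hasDerivAt_right (hψ.continuous.intervalIntegrable _ _)
      hψ.continuous.stronglyMeasurable.stronglyMeasurableAtFilter hψ.continuous.continuousAt
  have hΨs : ContDiff ℝ ∞ Ψ := by
    rw [contDiff_infty_iff_deriv]
    refine ⟨fun x => (hΨd x).differentiableAt, ?_⟩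
    rwa [show deriv Ψ = ψ from funext fun x => (hΨd x).deriv]
  have hΨ0 : ∀ x ≤ -B, Ψ x = 0 := by
    intro x hx
    rw [hΨ]
    simp only
    rw [intervalIntegral.integral_symm, neg_eq_zero]
    refine intervalIntegral.integral_zero_ae (Eventually.of_forall fun t ht => hB t ?_)
    rw [Set.uIoc_of_le hx] at ht
    rw [abs_of_nonpos (by linarith [ht.2])]
    linarith [ht.2]
  have hΨb : ∀ x, |Ψ x| ≤ ∫ t, |ψ t| := by
    intro x
    have hi : Integrable ψ := hψ.continuous.integrable_of_hasCompactSupport hψc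
    refine (intervalIntegral.norm_integral_le_integral_norm_uIoc (f := ψ)).trans ?_
    exact setIntegral_le_integral (f := fun t => ‖ψ t‖) hi.norm
      (Eventually.of_forall fun t => norm_nonneg _)
  set M := ∫ t, |ψ t| with hM
  let b : ContDiffBump (0 : ℝ) := ⟨1, 2, one_pos, one_lt_two⟩
  have hb : ContDiff ℝ ∞ b := b.contDiff
  obtain ⟨N, hN⟩ : ∃ N, ∀ x, ‖deriv b x‖ ≤ N :=
    (b.hasCompactSupport.deriv).exists_bound_of_continuous (hb.continuous_deriv (by simp))
  -- The error produced when the derivative falls on the cutoff `b (x / (n + 1))`.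
  set F : ℕ → ℝ → ℂ := fun n x =>
    Complex.exp (-airyPhase z x) * (Ψ x * (deriv b (x / (n + 1)) * (1 / (n + 1)) : ℝ)) * v x with hF
  have hbd : ∀ (n : ℕ) x, HasDerivAt (fun x : ℝ => b (x / (n + 1)))
      (deriv b (x / (n + 1)) * (1 / (n + 1))) x := by
    intro n x
    have h1 : HasDerivAt (fun x : ℝ => x / ((n : ℝ) + 1)) (1 / ((n : ℝ) + 1)) x :=
      (hasDerivAt_id x).div_const _
    exact ((hb.differentiable (by simp) _).hasDerivAt).comp x h1
  have hFn : ∀ᶠ n : ℕ in atTop, ∫ x, ψ x • (Complex.exp (-airyPhase z x) * v x) = -∫ x, F n x := by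
    filter_upwards [eventually_ge_atTop ⌈B⌉₊] with n hn
    have hnB : B ≤ n := Nat.ceil_le.1 hn
    have hn0 : (0 : ℝ) < n + 1 := by positivity
    set χ : ℝ → ℂ := fun x => ((Ψ x * b (x / (n + 1)) : ℝ) : ℂ) with hχ
    have hχs : ContDiff ℝ ∞ χ := by
      refine Complex.ofRealCLM.contDiff.comp (hΨs.mul (hb.comp ?_))
      fun_prop
    have hχc : HasCompactSupport χ := by
      refine HasCompactSupport.intro (isCompact_closedBall (0 : ℝ) (2 * (n + 1))) fun x hx => ?_
      rw [mem_closedBall_zero_iff, not_le, norm_eq_abs] at hx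
      have : b (x / (n + 1)) = 0 := by
        refine b.zero_of_le_dist ?_
        rw [dist_zero_right, norm_div, norm_eq_abs, norm_of_nonneg hn0.le, le_div_iff₀ hn0]
        exact hx.le
      simp [hχ, this]
    have hχd : ∀ x, deriv χ x =
        (ψ x : ℂ) + Ψ x * (deriv b (x / (n + 1)) * (1 / (n + 1)) : ℝ) := by
      intro x
      have h1 := ((hΨd x).mul (hbd n x)).ofReal_comp.deriv
      have h2 : ψ x * b (x / (n + 1)) = ψ x := by
        rcases lt_or_ge |x| B with hx | hx
        · rw [b.one_of_mem_closedBall, mul_one]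
          rw [mem_closedBall_zero_iff, norm_div, norm_eq_abs, norm_of_nonneg hn0.le,
            div_le_iff₀ hn0]
          change |x| ≤ 1 * ((n : ℝ) + 1)
          linarith
        · rw [hB x hx, zero_mul]
      refine h1.trans ?_
      rw [h2, Complex.ofReal_add, Complex.ofReal_mul]
    have hz := integral_exp_neg_airyPhase_mul_deriv_eq_zero hw h hχs hχc
    have i1 : Integrable fun x => ψ x • (Complex.exp (-airyPhase z x) * v x) :=
      (hv.continuous_mul hcE).integrable_smul_left_of_hasCompactSupport hψ.continuous hψc
    have i2 : Integrable fun x => Complex.exp (-airyPhase z x) * deriv χ x * v x :=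
      integrable_schwartz_mul (HasCompactSupport.toSchwartzMap
        (f := fun x => Complex.exp (-airyPhase z x) * deriv χ x) hχc.deriv.mul_left
        ((contDiff_airyPhase z).neg.cexp.mul (contDiff_infty_iff_deriv.1 hχs).2)) v
    have e : F n = fun x => Complex.exp (-airyPhase z x) * deriv χ x * v x -
        ψ x • (Complex.exp (-airyPhase z x) * v x) := by
      ext x
      rw [hχd, Complex.real_smul]
      simp only [hF]
      ring
    rw [e, integral_sub i2 i1, hz, zero_sub, neg_neg]
  have hlim : Tendsto (fun n => ∫ x, F n x) atTop (𝓝 (∫ _ : ℝ, (0 : ℂ))) := by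
    -- The dominating function is integrable because `e^{-Φ}` and `v` are both square integrable on
    -- `(-B, ∞)`.
    have hi : Integrable fun x => M * N *
        ‖(Set.Ioi (-B)).indicator (fun x => Complex.exp (-airyPhase z x)) x * v x‖ :=
      (((memLp_exp_neg_airyPhase z (-B)).integrable_mul (Lp.memLp v)).norm).const_mul _
    have hN0 : 0 ≤ N := (norm_nonneg _).trans (hN 0)
    have hM0 : 0 ≤ M := (abs_nonneg _).trans (hΨb 0)
    refine tendsto_integral_of_dominated_convergence _ (fun n => ?_) hi (fun n => ?_) ?_
    · refine AEStronglyMeasurable.mul (Continuous.aestronglyMeasurable ?_)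
        (Lp.aestronglyMeasurable v)
      have h1 : Continuous (deriv b) := hb.continuous_deriv (by simp)
      have h2 := hΨs.continuous
      fun_prop
    · refine Eventually.of_forall fun x => ?_
      rcases le_or_gt x (-B) with hx | hx
      · simp only [hF, hΨ0 x hx]
        simp only [Complex.ofReal_zero, zero_mul, mul_zero, norm_zero]
        positivity
      · rw [Set.indicator_of_mem (Set.mem_Ioi.2 hx)]
        simp only [hF, norm_mul, Complex.norm_real]
        have h1 : ‖(1 / ((n : ℝ) + 1))‖ ≤ 1 := by
          rw [norm_of_nonneg (by positivity), div_le_one (by positivity)]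
          linarith [show (0 : ℝ) ≤ n by positivity]
        calc ‖Complex.exp (-airyPhase z x)‖ * (‖Ψ x‖ * (‖deriv b (x / (n + 1))‖ *
              ‖(1 / ((n : ℝ) + 1))‖)) * ‖v x‖
            ≤ ‖Complex.exp (-airyPhase z x)‖ * (M * (N * 1)) * ‖v x‖ := by
              gcongr
              · exact hΨb x
              · exact hN _
          _ = _ := by ring
    · refine Eventually.of_forall fun x => ?_
      have h1 : Tendsto (fun n : ℕ => deriv b (x / (n + 1)) * (1 / ((n : ℝ) + 1))) atTop (𝓝 0) := by
        refine squeeze_zero_norm (a := fun n : ℕ => N * (1 / ((n : ℝ) + 1))) (fun n => ?_) ?_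
        · rw [norm_mul, norm_of_nonneg (show (0 : ℝ) ≤ 1 / ((n : ℝ) + 1) by positivity)]
          gcongr
          exact hN _
        · simpa using tendsto_one_div_add_atTop_nhds_zero_nat.const_mul N
      have h2 := ((Complex.continuous_ofReal.tendsto 0).comp h1).const_mul (Ψ x : ℂ)
      have h3 := (h2.const_mul (Complex.exp (-airyPhase z x))).mul_const (v x)
      simpa [hF] using h3
  rw [integral_zero] at hlim
  have h1 := hlim.neg
  rw [neg_zero] at h1
  exact tendsto_nhds_unique (tendsto_const_nhds.congr' hFn) h1

end

section

/-! ### Laplace expansion -/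

open Real

/-- Invert `e^{-y} ≥ 1 - y + y²/2`, using `(1 + y + y²/2)(1 - y + y²/2) = 1 + y⁴/4 ≥ 1`. -/
theorem exp_le_quadratic_of_nonpos {y : ℝ} (hy : y ≤ 0) : exp y ≤ 1 + y + y ^ 2 / 2 := by
  have h := quadratic_le_exp_of_nonneg (neg_nonneg.2 hy)
  have h1 : exp y * exp (-y) = 1 := by rw [← exp_add, add_neg_cancel, exp_zero]
  have h2 : 0 < 1 + y + y ^ 2 / 2 := by nlinarith [sq_nonneg (y + 1)]
  have h3 : 0 < exp (-y) := exp_pos _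
  by_contra! hc
  have h4 := mul_lt_mul_of_pos_right hc h3
  have h5 := mul_le_mul_of_nonneg_left h h2.le
  nlinarith [sq_nonneg (y ^ 2)]

/-- Multiply `e^{-y} ≥ 1 - y` by `(1 + y) e^y`. -/
theorem exp_sub_le_sq_mul_exp {y : ℝ} (hy : 0 ≤ y) : exp y - 1 - y ≤ y ^ 2 * exp y := by
  have h := add_one_le_exp (-y)
  have h1 : exp y * exp (-y) = 1 := by rw [← exp_add, add_neg_cancel, exp_zero]
  have h3 : 0 < exp y := exp_pos _
  have h4 := mul_le_mul_of_nonneg_left h (mul_nonneg (show 0 ≤ 1 + y by linarith) h3.le)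
  nlinarith

/-- Second-order expansion of the cubic perturbation of a Gaussian. -/
theorem abs_indicator_exp_sub_le {a : ℝ} (ha : 1 ≤ a) (s : ℝ) :
    |(Set.Ioi (-a)).indicator (fun s => exp (-(2 * a * s ^ 2) - 2 * s ^ 3 / 3)) s -
      exp (-(2 * a) * s ^ 2) * (1 - 2 / 3 * s ^ 3)| ≤ 2 * (s ^ 6 * exp (-(4 / 3) * (a * s ^ 2))) := by
  have hE : exp (-(2 * a) * s ^ 2) ≤ exp (-(4 / 3) * (a * s ^ 2)) :=
    exp_le_exp.2 (by nlinarith [mul_nonneg (zero_le_one.trans ha) (sq_nonneg s)])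
  have hE0 : 0 < exp (-(2 * a) * s ^ 2) := exp_pos _
  have h6 : 0 ≤ s ^ 6 := by positivity
  have hsplit : exp (-(2 * a * s ^ 2) - 2 * s ^ 3 / 3) =
      exp (-(2 * a) * s ^ 2) * exp (-(2 / 3 * s ^ 3)) := by
    rw [← exp_add]
    ring_nf
  rcases le_or_gt s (-a) with h | h
  · rw [Set.indicator_of_notMem (by simpa using h), zero_sub, abs_neg, abs_mul, abs_of_pos hE0]
    have h3 : s ^ 3 ≤ 0 := by
      have : 0 ≤ (-s) ^ 3 := pow_nonneg (by linarith) 3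
      linarith [show (-s) ^ 3 = -s ^ 3 by ring]
    have h1 : 1 ≤ (-s) ^ 3 := one_le_pow₀ (by linarith)
    have h2 : |1 - 2 / 3 * s ^ 3| ≤ 2 * s ^ 6 := by
      rw [abs_of_nonneg (by linarith)]
      nlinarith
    calc exp (-(2 * a) * s ^ 2) * |1 - 2 / 3 * s ^ 3|
        ≤ exp (-(4 / 3) * (a * s ^ 2)) * (2 * s ^ 6) := by gcongr
      _ = _ := by ring
  · rw [Set.indicator_of_mem (by simpa using h), hsplit, ← mul_sub, abs_mul, abs_of_pos hE0]
    rcases le_or_gt 0 s with hs | hs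
    · have hy : -(2 / 3 * s ^ 3) ≤ 0 := by
        have := pow_nonneg hs 3
        linarith
      have h1 := exp_le_quadratic_of_nonpos hy
      have h2 := add_one_le_exp (-(2 / 3 * s ^ 3))
      have h3 : |exp (-(2 / 3 * s ^ 3)) - (1 - 2 / 3 * s ^ 3)| ≤ 2 * s ^ 6 := by
        rw [abs_of_nonneg (by linarith)]
        nlinarith
      calc exp (-(2 * a) * s ^ 2) * |exp (-(2 / 3 * s ^ 3)) - (1 - 2 / 3 * s ^ 3)|
          ≤ exp (-(4 / 3) * (a * s ^ 2)) * (2 * s ^ 6) := by gcongr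
        _ = _ := by ring
    · have hy : 0 ≤ -(2 / 3 * s ^ 3) := by
        have : 0 ≤ (-s) ^ 3 := pow_nonneg (by linarith) 3
        linarith [show (-s) ^ 3 = -s ^ 3 by ring]
      have h1 := exp_sub_le_sq_mul_exp hy
      have h2 := add_one_le_exp (-(2 / 3 * s ^ 3))
      -- Since `-a < s < 0`, the cubic costs at most `(2/3) a s²`; out of `2a s²` this leaves the
      -- rate `4/3` of the statement.
      have h4 : exp (-(2 / 3 * s ^ 3)) ≤ exp (2 / 3 * (a * s ^ 2)) :=
        exp_le_exp.2 (by nlinarith [mul_nonneg (show 0 ≤ a + s by linarith) (sq_nonneg s)])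
      have h3 : |exp (-(2 / 3 * s ^ 3)) - (1 - 2 / 3 * s ^ 3)| ≤
          2 * s ^ 6 * exp (2 / 3 * (a * s ^ 2)) := by
        rw [abs_of_nonneg (by linarith)]
        have h5 : (-(2 / 3 * s ^ 3)) ^ 2 * exp (-(2 / 3 * s ^ 3)) ≤
            2 * s ^ 6 * exp (2 / 3 * (a * s ^ 2)) := by
          gcongr
          nlinarith
        linarith
      calc exp (-(2 * a) * s ^ 2) * |exp (-(2 / 3 * s ^ 3)) - (1 - 2 / 3 * s ^ 3)|
          ≤ exp (-(2 * a) * s ^ 2) * (2 * s ^ 6 * exp (2 / 3 * (a * s ^ 2))) := by gcongr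
        _ = 2 * (s ^ 6 * (exp (-(2 * a) * s ^ 2) * exp (2 / 3 * (a * s ^ 2)))) := by ring
        _ = _ := by
          rw [← exp_add]
          ring_nf

theorem integrable_pow_mul_exp_neg_mul_sq {b : ℝ} (hb : 0 < b) (n : ℕ) :
    Integrable fun x : ℝ => x ^ n * exp (-b * x ^ 2) := by
  have h : (-1 : ℝ) < n := by
    have : (0 : ℝ) ≤ n := by positivity
    linarith
  simpa only [rpow_natCast] using integrable_rpow_mul_exp_neg_mul_sq hb h

/-- The constant in the remainder of the Laplace expansion. -/
def gaussianSixthMoment : ℝ := ∫ t : ℝ, t ^ 6 * exp (-(4 / 3) * t ^ 2)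

theorem gaussianSixthMoment_nonneg : 0 ≤ gaussianSixthMoment :=
  integral_nonneg fun t => by positivity

theorem integral_pow_six_mul_exp {c : ℝ} (hc : 0 < c) :
    ∫ s : ℝ, s ^ 6 * exp (-(4 / 3) * (c ^ 2 * s ^ 2)) = gaussianSixthMoment / c ^ 7 := by
  have h := Measure.integral_comp_mul_left (fun t : ℝ => t ^ 6 * exp (-(4 / 3) * t ^ 2)) c
  rw [abs_of_pos (inv_pos.2 hc), smul_eq_mul] at h
  have h2 : ∀ s : ℝ, (c * s) ^ 6 * exp (-(4 / 3) * (c * s) ^ 2) =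
      c ^ 6 * (s ^ 6 * exp (-(4 / 3) * (c ^ 2 * s ^ 2))) := by
    intro s
    rw [mul_pow, mul_pow]
    ring
  simp only [h2] at h
  rw [integral_const_mul] at h
  change c ^ 6 * _ = c⁻¹ * gaussianSixthMoment at h
  rw [eq_div_iff (by positivity), pow_succ c 6, mul_comm, mul_right_comm, h]
  field_simp

theorem integral_cube_mul_exp (b : ℝ) : ∫ s : ℝ, s ^ 3 * exp (-b * s ^ 2) = 0 := by
  have h := integral_neg_eq_self (fun s : ℝ => s ^ 3 * exp (-b * s ^ 2)) volume
  have h2 : ∀ s : ℝ, (-s) ^ 3 * exp (-b * (-s) ^ 2) = -(s ^ 3 * exp (-b * s ^ 2)) := by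
    intro s
    rw [neg_sq]
    ring
  simp only [h2, integral_neg] at h
  linarith

/-- Laplace expansion of `∫_0^∞ exp(2 c⁴ y - 2 y³ / 3) dy` as `c → ∞`. -/
theorem abs_integral_exp_cubic_sub_le {c : ℝ} (hc : 1 ≤ c) :
    |(∫ y in Set.Ioi (0 : ℝ), exp (-2 * (y ^ 3 / 3 - c ^ 4 * y))) -
      exp (4 / 3 * c ^ 6) * (√(π / 2) / c)| ≤
      exp (4 / 3 * c ^ 6) * (2 * gaussianSixthMoment / c ^ 7) := by
  have hc0 : 0 < c := by linarith
  set f := (Set.Ioi (-c ^ 2)).indicator (fun s => exp (-(2 * c ^ 2 * s ^ 2) - 2 * s ^ 3 / 3)) with hf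
  -- Shift to the critical point, `y = s + c²`: the exponent becomes `(4/3)c⁶ - 2c²s² - (2/3)s³`.
  have hI : ∫ y in Set.Ioi (0 : ℝ), exp (-2 * (y ^ 3 / 3 - c ^ 4 * y)) =
      exp (4 / 3 * c ^ 6) * ∫ s, f s := by
    rw [← integral_indicator measurableSet_Ioi, ← integral_const_mul,
      ← integral_add_right_eq_self _ (c ^ 2)]
    congr 1 with s
    by_cases h : -c ^ 2 < s
    · rw [hf, Set.indicator_of_mem (Set.mem_Ioi.2 (by linarith)),
        Set.indicator_of_mem (Set.mem_Ioi.2 h), ← exp_add]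
      ring_nf
    · rw [hf, Set.indicator_of_notMem (by simpa using (by linarith : s + c ^ 2 ≤ 0)),
        Set.indicator_of_notMem (by simpa using h), mul_zero]
  -- The cubic correction is odd and integrates to zero, so the relative error is of order `c⁻⁶`
  -- rather than `c⁻³`.
  have hg : ∫ s : ℝ, exp (-(2 * c ^ 2) * s ^ 2) * (1 - 2 / 3 * s ^ 3) = √(π / 2) / c := by
    have e : ∀ s : ℝ, exp (-(2 * c ^ 2) * s ^ 2) * (1 - 2 / 3 * s ^ 3) =
        exp (-(2 * c ^ 2) * s ^ 2) - 2 / 3 * (s ^ 3 * exp (-(2 * c ^ 2) * s ^ 2)) := by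
      intro s
      ring
    simp only [e]
    rw [integral_sub (integrable_exp_neg_mul_sq (by positivity))
      ((integrable_pow_mul_exp_neg_mul_sq (by positivity) 3).const_mul _), integral_const_mul,
      integral_cube_mul_exp, integral_gaussian, mul_zero, sub_zero,
      show π / (2 * c ^ 2) = (π / 2) / c ^ 2 by field_simp, sqrt_div (by positivity), sqrt_sq hc0.le]
  have ig : Integrable fun s : ℝ => exp (-(2 * c ^ 2) * s ^ 2) * (1 - 2 / 3 * s ^ 3) := by
    have := (integrable_exp_neg_mul_sq (b := 2 * c ^ 2) (by positivity)).sub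
      ((integrable_pow_mul_exp_neg_mul_sq (b := 2 * c ^ 2) (by positivity) 3).const_mul (2 / 3))
    refine this.congr (Filter.Eventually.of_forall fun s => ?_)
    simp only [Pi.sub_apply]
    ring
  have ih : Integrable fun s : ℝ => 2 * (s ^ 6 * exp (-(4 / 3) * (c ^ 2 * s ^ 2))) := by
    have := (integrable_pow_mul_exp_neg_mul_sq (b := 4 / 3 * c ^ 2) (by positivity) 6).const_mul 2
    refine this.congr (Filter.Eventually.of_forall fun s => ?_)
    ring_nf
  have hbound : ∀ s, |f s - exp (-(2 * c ^ 2) * s ^ 2) * (1 - 2 / 3 * s ^ 3)| ≤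
      2 * (s ^ 6 * exp (-(4 / 3) * (c ^ 2 * s ^ 2))) :=
    abs_indicator_exp_sub_le (one_le_pow₀ hc)
  have hfm : AEStronglyMeasurable f := by
    refine AEStronglyMeasurable.indicator ?_ measurableSet_Ioi
    exact Continuous.aestronglyMeasurable (by fun_prop)
  have id : Integrable fun s => f s - exp (-(2 * c ^ 2) * s ^ 2) * (1 - 2 / 3 * s ^ 3) :=
    ih.mono' (hfm.sub ig.1) (Filter.Eventually.of_forall hbound)
  have if' : Integrable f := by
    refine (id.add ig).congr (Filter.Eventually.of_forall fun s => ?_)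
    simp
  rw [hI, ← hg, ← mul_sub, abs_mul, abs_of_pos (exp_pos _), ← integral_sub if' ig]
  gcongr
  refine (abs_integral_le_integral_abs).trans ((integral_mono id.abs ih hbound).trans (le_of_eq ?_))
  rw [integral_const_mul, integral_pow_six_mul_exp hc0]
  ring

end

section

/-! ### The norm of the resolvent -/

open Real Filter Topology
open scoped ENNReal NNReal

theorem airyPhase_neg (z : ℂ) (x : ℝ) : airyPhase z (-x) = -airyPhase z x := by
  simp only [airyPhase]
  push_cast
  ring

/-- The function `√(2π) e^{-Φ}` on the positive half-line. -/
def airyProfile (z : ℂ) (x : ℝ) : ℂ :=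
  (√(2 * π) : ℂ) * (Set.Ioi 0).indicator (fun x => Complex.exp (-airyPhase z x)) x

theorem memLp_airyProfile (z : ℂ) : MemLp (airyProfile z) 2 volume :=
  (memLp_exp_neg_airyPhase z 0).const_mul _

theorem memLp_airyProfile_comp_neg (z : ℂ) : MemLp (fun x => airyProfile z (-x)) 2 volume :=
  (memLp_airyProfile z).comp_measurePreserving (Measure.measurePreserving_neg volume)

theorem memLp_conj_airyProfile (z : ℂ) :
    MemLp (fun x => starRingEnd ℂ (airyProfile z x)) 2 volume :=
  (memLp_airyProfile z).star

theorem norm_sq_toLp_eq {f : ℝ → ℂ} (hf : MemLp f 2 volume) :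
    ‖hf.toLp‖ ^ 2 = ∫ x, ‖f x‖ ^ 2 := by
  set F : L2R := hf.toLp with hF
  have h := L2.inner_def (𝕜 := ℂ) F F
  rw [inner_self_eq_norm_sq_to_K] at h
  have h2 : ∫ x, inner ℂ (F x) (F x) = ((∫ x, ‖f x‖ ^ 2 : ℝ) : ℂ) := by
    rw [← integral_complex_ofReal]
    refine integral_congr_ae ?_
    filter_upwards [hf.coeFn_toLp] with x hx
    rw [hx, inner_self_eq_norm_sq_to_K]
    simp
  rw [h2] at h
  exact Complex.ofReal_injective ((Complex.ofReal_pow _ _).trans h)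

theorem integral_norm_airyProfile_sq (z : ℂ) :
    ∫ x, ‖airyProfile z x‖ ^ 2 =
      ∫ y in Set.Ioi (0 : ℝ), exp (-2 * (y ^ 3 / 3 - z.re * y)) := by
  have h := integral_comp_mul_left_Ioi (fun y => exp (-2 * (y ^ 3 / 3 - z.re * y))) 0
    (show 0 < 2 * π by positivity)
  rw [mul_zero, smul_eq_mul] at h
  have h1 : ∀ x, ‖airyProfile z x‖ ^ 2 = (Set.Ioi (0 : ℝ)).indicator (fun x =>
      2 * π * exp (-2 * ((2 * π * x) ^ 3 / 3 - z.re * (2 * π * x)))) x := by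
    intro x
    rw [airyProfile, norm_mul, mul_pow, Complex.norm_real, norm_of_nonneg (by positivity),
      sq_sqrt (by positivity)]
    by_cases hx : x ∈ Set.Ioi (0 : ℝ)
    · rw [Set.indicator_of_mem hx, Set.indicator_of_mem hx, norm_exp_neg_airyPhase,
        ← exp_nat_mul]
      push_cast
      ring_nf
    · rw [Set.indicator_of_notMem hx, Set.indicator_of_notMem hx]
      simp
  simp only [h1]
  rw [integral_indicator measurableSet_Ioi, integral_const_mul, h, ← mul_assoc,
    mul_inv_cancel₀ (by positivity), one_mul]

/-- The restriction of the Airy kernel to the quadrant `x < 0 < y`, as a rank one operator. -/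
def airyRankOne (z : ℂ) : L2R →L[ℂ] L2R :=
  -- The conjugate cancels the one in the first slot of the inner product.
  InnerProductSpace.rankOne ℂ (memLp_airyProfile_comp_neg z).toLp (memLp_conj_airyProfile z).toLp

theorem norm_airyRankOne (z : ℂ) :
    ‖airyRankOne z‖ = ∫ y in Set.Ioi (0 : ℝ), exp (-2 * (y ^ 3 / 3 - z.re * y)) := by
  have h1 : ‖(memLp_airyProfile_comp_neg z).toLp‖ ^ 2 = ∫ x, ‖airyProfile z x‖ ^ 2 := by
    rw [norm_sq_toLp_eq]
    exact integral_neg_eq_self (fun x => ‖airyProfile z x‖ ^ 2) volume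
  have h2 : ‖(memLp_conj_airyProfile z).toLp‖ ^ 2 = ∫ x, ‖airyProfile z x‖ ^ 2 := by
    rw [norm_sq_toLp_eq]
    simp
  rw [airyRankOne, InnerProductSpace.norm_rankOne, ← integral_norm_airyProfile_sq]
  have h3 : ‖(memLp_airyProfile_comp_neg z).toLp‖ = ‖(memLp_conj_airyProfile z).toLp‖ := by
    rw [← sq_eq_sq₀ (norm_nonneg _) (norm_nonneg _), h1, h2]
  rw [h3, ← sq, h2]

theorem coeFn_airyRankOne (z : ℂ) (g : L2R) :
    airyRankOne z g =ᵐ[volume] fun x => ∫ y, airyProfile z (-x) * airyProfile z y * g y := by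
  rw [airyRankOne, InnerProductSpace.rankOne_apply]
  have h : inner ℂ (memLp_conj_airyProfile z).toLp g = ∫ y, airyProfile z y * g y := by
    rw [L2.inner_def]
    refine integral_congr_ae ?_
    filter_upwards [(memLp_conj_airyProfile z).coeFn_toLp] with y hy
    rw [hy, RCLike.inner_apply, RingHomCompTriple.comp_apply, RingHom.id_apply, mul_comm]
  filter_upwards [Lp.coeFn_smul (inner ℂ (memLp_conj_airyProfile z).toLp g)
    (memLp_airyProfile_comp_neg z).toLp, (memLp_airyProfile_comp_neg z).coeFn_toLp] with x h1 h2
  rw [h1, Pi.smul_apply, h2, h, smul_eq_mul, mul_comm, ← integral_const_mul]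
  simp only [mul_assoc]

/-- The Airy kernel outside the quadrant `x < 0 < y`. -/
def airyRemainder (z : ℂ) (x y : ℝ) : ℂ := if x < 0 ∧ 0 < y then 0 else airyKernel z x y

theorem measurable_airyRemainder (z : ℂ) : Measurable (Function.uncurry (airyRemainder z)) := by
  refine Measurable.ite ?_ measurable_const (measurable_airyKernel z)
  exact (measurableSet_lt measurable_fst measurable_const).inter
    (measurableSet_lt measurable_const measurable_snd)

theorem airyKernel_eq (z : ℂ) (x y : ℝ) :
    airyKernel z x y = airyProfile z (-x) * airyProfile z y + airyRemainder z x y := by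
  by_cases h : x < 0 ∧ 0 < y
  · have hs : (√(2 * π) : ℂ) * (√(2 * π) : ℂ) = 2 * π := by
      rw [← Complex.ofReal_mul, mul_self_sqrt (by positivity)]
      simp
    rw [airyRemainder, if_pos h, add_zero, airyKernel_of_lt z (h.1.trans h.2), airyProfile,
      airyProfile, Set.indicator_of_mem (Set.mem_Ioi.2 (neg_pos.2 h.1)),
      Set.indicator_of_mem (Set.mem_Ioi.2 h.2), airyPhase_neg, neg_neg, sub_eq_add_neg,
      Complex.exp_add, ← hs]
    ring
  · rw [airyRemainder, if_neg h, airyProfile, airyProfile]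
    rcases not_and_or.1 h with h | h
    · rw [Set.indicator_of_notMem (s := Set.Ioi 0) (a := -x) (by simpa using h)]
      simp
    · rw [Set.indicator_of_notMem (s := Set.Ioi 0) (a := y) (by simpa using h)]
      simp

/-- Beyond `a` the cubic increases. For `0 ≤ X < a` its value at `X` is nonpositive, and its minimum
over `Y ≥ 0` is `-2a³/3`, by `Y³ - 3a²Y + 2a³ = (Y - a)²(Y + 2a)`. -/
theorem cubic_sub_le_of_nonneg {a X Y : ℝ} (ha : 0 ≤ a) (hX : 0 ≤ X) (h : X < Y) :
    X ^ 3 / 3 - a ^ 2 * X - (Y ^ 3 / 3 - a ^ 2 * Y) ≤ 2 / 3 * a ^ 3 := by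
  rcases le_or_gt a X with haX | haX
  · have h1 : 0 ≤ (Y - X) * ((X ^ 2 + X * Y + Y ^ 2) / 3 - a ^ 2) :=
      mul_nonneg (by linarith) (by nlinarith)
    have := pow_nonneg ha 3
    nlinarith
  · have h1 : X * (X ^ 2 / 3 - a ^ 2) ≤ 0 :=
      mul_nonpos_of_nonneg_of_nonpos hX (by nlinarith)
    have h2 : 0 ≤ (Y - a) ^ 2 * (Y + 2 * a) := mul_nonneg (sq_nonneg _) (by linarith)
    nlinarith

theorem cubic_sub_le_of_dist_le {a X Y : ℝ} (ha : 0 ≤ a) (h : X < Y) (hn : ¬(X < 0 ∧ 0 < Y)) :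
    X ^ 3 / 3 - a ^ 2 * X - (Y ^ 3 / 3 - a ^ 2 * Y) ≤ 2 / 3 * a ^ 3 := by
  rcases not_and_or.1 hn with hX | hY
  · exact cubic_sub_le_of_nonneg ha (not_lt.1 hX) h
  · have := cubic_sub_le_of_nonneg ha (neg_nonneg.2 (not_lt.1 hY)) (neg_lt_neg h)
    linarith

/-- The loss `4a` buys the decay in `Y - X` that Schur's test needs. Past distance `4a`, `X² + XY +
Y² ≥ (Y - X)²/4 ≥ 4a²`, and a third of this exceeds `a² + 1` because `a² ≥ 3`. -/
theorem cubic_sub_le {a X Y : ℝ} (ha : 3 ≤ a ^ 2) (ha0 : 0 ≤ a) (h : X < Y)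
    (hn : ¬(X < 0 ∧ 0 < Y)) :
    X ^ 3 / 3 - a ^ 2 * X - (Y ^ 3 / 3 - a ^ 2 * Y) ≤ 2 / 3 * a ^ 3 + 4 * a - (Y - X) := by
  rcases le_or_gt (Y - X) (4 * a) with hd | hd
  · have := cubic_sub_le_of_dist_le ha0 h hn
    linarith
  · have h1 : 0 < Y - X := by linarith
    have h2 : 16 * a ^ 2 ≤ (Y - X) ^ 2 := by nlinarith
    have h3 : 0 ≤ (Y - X) * ((X ^ 2 + X * Y + Y ^ 2) / 3 - a ^ 2 - 1) :=
      mul_nonneg h1.le (by nlinarith [sq_nonneg (X + Y)])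
    have := pow_nonneg ha0 3
    nlinarith

theorem isSchurKernel_airyRemainder {z : ℂ} {a : ℝ} (ha0 : 0 ≤ a) (ha : z.re = a ^ 2)
    (ha3 : 3 ≤ a ^ 2) :
    IsSchurKernel (airyRemainder z) (exp (2 / 3 * a ^ 3 + 4 * a)).toNNReal := by
  have hp : 0 < 2 * π := by positivity
  have hb : ∀ x y, x < y → ‖airyRemainder z x y‖ ≤ (exp (2 / 3 * a ^ 3 + 4 * a)).toNNReal *
      (2 * π * exp (-(2 * π * (y - x)))) := by
    intro x y h
    rw [coe_toNNReal _ (exp_nonneg _)]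
    by_cases hn : x < 0 ∧ 0 < y
    · rw [airyRemainder, if_pos hn, norm_zero]
      positivity
    · rw [airyRemainder, if_neg hn, norm_airyKernel_of_lt z h, ha]
      have h1 := cubic_sub_le ha3 ha0 (mul_lt_mul_of_pos_left h hp)
        (fun h' => hn ⟨neg_of_mul_neg_right h'.1 hp.le, pos_of_mul_pos_right h'.2 hp.le⟩)
      calc 2 * π * exp ((2 * π * x) ^ 3 / 3 - a ^ 2 * (2 * π * x) -
            ((2 * π * y) ^ 3 / 3 - a ^ 2 * (2 * π * y)))
          ≤ 2 * π * exp (2 / 3 * a ^ 3 + 4 * a + -(2 * π * (y - x))) := by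
            gcongr 2 * π * exp ?_
            linarith
        _ = _ := by
            rw [exp_add]
            ring
  refine IsSchurKernel.of_exp_bound (measurable_airyRemainder z) (s := fun _ => 2 * π)
    (t := fun _ => 2 * π) (fun _ => hp) (fun _ => hp) (fun x y h => ?_) hb hb
  rw [airyRemainder]
  split_ifs
  · rfl
  · exact airyKernel_of_le z h

theorem airyFourierResolvent_eq {z : ℂ} {A : ℝ≥0} (hA : IsSchurKernel (airyRemainder z) A) :
    airyFourierResolvent z = airyRankOne z + hA.toCLM := by
  ext1 g
  refine Lp.ext ?_
  have hg := Lp.memLp g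
  filter_upwards [(isSchurKernel_airyKernel z).coeFn_toCLM g, coeFn_airyRankOne z g,
    hA.coeFn_toCLM g, hA.ae_integrable hg, Lp.coeFn_add (airyRankOne z g) (hA.toCLM g)]
    with x h1 h2 h3 h4 h5
  rw [airyFourierResolvent, h1, _root_.add_apply, h5, Pi.add_apply, h2, h3,
    ← integral_add _ h4]
  · simp only [airyKernel_eq, add_mul]
  · simp only [mul_assoc]
    exact ((memLp_airyProfile z).integrable_mul hg).const_mul _

/-- The norm of the resolvent of the complex Airy operator is that of its rank one part, up to an
exponentially smaller remainder. -/
theorem abs_norm_airyFourierResolvent_sub_le {z : ℂ} {a : ℝ} (ha0 : 0 ≤ a) (ha : z.re = a ^ 2)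
    (ha3 : 3 ≤ a ^ 2) :
    |‖airyFourierResolvent z‖ - ∫ y in Set.Ioi (0 : ℝ), exp (-2 * (y ^ 3 / 3 - z.re * y))| ≤
      exp (2 / 3 * a ^ 3 + 4 * a) := by
  have hA := isSchurKernel_airyRemainder ha0 ha ha3
  rw [← norm_airyRankOne]
  refine (abs_norm_sub_norm_le _ _).trans ?_
  rw [airyFourierResolvent_eq hA, add_sub_cancel_left]
  exact hA.norm_toCLM_le.trans_eq (coe_toNNReal _ (exp_nonneg _))

/-- For `c ≥ 2`, `4c² ≤ c⁶/4`, while `c⁷ ≤ c¹² ≤ 18 e^{c⁶/3}` by the quadratic Taylor term; and `2/3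
+ 1/4 + 1/3 = 5/4 < 4/3`. -/
theorem exp_remainder_le {c : ℝ} (hc : 2 ≤ c) :
    exp (2 / 3 * (c ^ 2) ^ 3 + 4 * c ^ 2) ≤ exp (4 / 3 * c ^ 6) * (18 / c ^ 7) := by
  have h4 : (16 : ℝ) ≤ c ^ 4 := by
    have := pow_le_pow_left₀ (by norm_num) hc 4
    linarith
  have h1 : 4 * c ^ 2 ≤ c ^ 6 / 4 := by nlinarith [sq_nonneg c]
  have h2 : c ^ 7 ≤ c ^ 12 := pow_le_pow_right₀ (by linarith) (by norm_num)
  have h3 : c ^ 12 ≤ 18 * exp (c ^ 6 / 3) := by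
    have := quadratic_le_exp_of_nonneg (show 0 ≤ c ^ 6 / 3 by positivity)
    have : 0 ≤ c ^ 6 := by positivity
    nlinarith
  have hc7 : 0 < c ^ 7 := by positivity
  rw [mul_div_assoc', le_div_iff₀ hc7]
  calc exp (2 / 3 * (c ^ 2) ^ 3 + 4 * c ^ 2) * c ^ 7
      ≤ exp (2 / 3 * (c ^ 2) ^ 3 + 4 * c ^ 2) * (18 * exp (c ^ 6 / 3)) := by
        gcongr
        exact h2.trans h3
    _ = exp (2 / 3 * (c ^ 2) ^ 3 + 4 * c ^ 2 + c ^ 6 / 3) * 18 := by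
        rw [exp_add _ (c ^ 6 / 3)]
        ring
    _ ≤ _ := by
        gcongr
        nlinarith [show (c ^ 2) ^ 3 = c ^ 6 by ring, show 0 ≤ c ^ 6 by positivity]

theorem abs_norm_airyFourierResolvent_sub_main_le {z : ℂ} {c : ℝ} (hc : 2 ≤ c)
    (hz : z.re = c ^ 4) :
    |‖airyFourierResolvent z‖ - exp (4 / 3 * c ^ 6) * (√(π / 2) / c)| ≤
      exp (4 / 3 * c ^ 6) * ((2 * gaussianSixthMoment + 18) / c ^ 7) := by
  have h4 : (4 : ℝ) ≤ c ^ 2 := by nlinarith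
  have h1 := abs_norm_airyFourierResolvent_sub_le (z := z) (a := c ^ 2) (by positivity)
    (by rw [hz]; ring) (by nlinarith)
  have h2 := abs_integral_exp_cubic_sub_le (c := c) (by linarith)
  rw [hz] at h1
  have h3 := exp_remainder_le hc
  refine (abs_sub_le _ _ _).trans ((add_le_add (h1.trans h3) h2).trans (le_of_eq ?_))
  ring

end

section

/-! ### The resolvent -/

open Real FourierTransform

/-- The resolvent of the complex Airy operator. -/
def airyResolvent (z : ℂ) : L2R →L[ℂ] L2R :=
  ((Lp.fourierTransformₗᵢ ℝ ℂ).symm : L2R →L[ℂ] L2R) ∘L airyFourierResolvent z ∘L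
    (Lp.fourierTransformₗᵢ ℝ ℂ : L2R →L[ℂ] L2R)

theorem airyResolvent_apply (z : ℂ) (f : L2R) :
    airyResolvent z f = 𝓕⁻ (airyFourierResolvent z (𝓕 f)) := rfl

theorem norm_airyResolvent (z : ℂ) : ‖airyResolvent z‖ = ‖airyFourierResolvent z‖ := by
  apply le_antisymm
  · refine ContinuousLinearMap.opNorm_le_bound _ (norm_nonneg _) fun f => ?_
    rw [airyResolvent_apply]
    refine ((Lp.fourierTransformₗᵢ ℝ ℂ).symm.norm_map _).trans_le ?_
    refine ((airyFourierResolvent z).le_opNorm _).trans_eq ?_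
    rw [Lp.norm_fourier_eq]
  · refine ContinuousLinearMap.opNorm_le_bound _ (norm_nonneg _) fun f => ?_
    have h : airyFourierResolvent z f = 𝓕 (airyResolvent z (𝓕⁻ f)) := by
      rw [airyResolvent_apply, FourierTransform.fourier_fourierInv_eq,
        FourierTransform.fourier_fourierInv_eq]
    rw [h, Lp.norm_fourier_eq]
    refine ((airyResolvent z).le_opNorm _).trans_eq ?_
    congr 1
    exact (Lp.fourierTransformₗᵢ ℝ ℂ).symm.norm_map _

theorem airyOp_airyResolvent (z : ℂ) (f : L2R) :
    ∃ hf : airyResolvent z f ∈ airyOp.domain,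
      airyOp ⟨airyResolvent z f, hf⟩ - z • airyResolvent z f = f := by
  obtain ⟨h, he⟩ := exists_airyOp_fourierInv_eq (sq_mul_airyFourierResolvent z (𝓕 f))
    (derivCLM_airyFourierResolvent z (𝓕 f))
  refine ⟨h, ?_⟩
  have hpi : (2 * π : ℂ) ≠ 0 := by simp [pi_ne_zero]
  have e : airyOp ⟨airyResolvent z f, h⟩ = _ := he
  rw [e, smul_smul, one_div_mul_cancel hpi, one_smul, sub_sub, sub_sub_cancel,
    FourierTransform.fourierInv_add, FourierTransform.fourierInv_smul,
    FourierTransform.fourierInv_fourier_eq, airyResolvent_apply, add_sub_cancel_left]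

/-- The complex Airy operator has no eigenvalues. -/
theorem eq_zero_of_airyOp_eq_smul {z : ℂ} (u : airyOp.domain) (h : airyOp u = z • (u : L2R)) :
    (u : L2R) = 0 := by
  obtain ⟨k, w, hk, hw, he⟩ := exists_fourier_airyOp_eq u
  have hpi : (2 * π : ℂ) ≠ 0 := by simp [pi_ne_zero]
  rw [h, FourierTransform.fourier_smul] at he
  set v : L2R := 𝓕 (u : L2R) with hv
  have hw' : w = (2 * π : ℂ) • (((2 * π) ^ 2 : ℂ) • k - z • v) := by
    rw [he, sub_sub_cancel, smul_smul, mul_one_div_cancel hpi, one_smul]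
  have hv0 : v = 0 := by
    refine eq_zero_of_derivCLM_eq (z := z) (w := w) ?_ hw
    rw [hw']
    filter_upwards [hk, Lp.coeFn_smul (2 * π : ℂ) (((2 * π) ^ 2 : ℂ) • k - z • v),
      Lp.coeFn_sub (((2 * π) ^ 2 : ℂ) • k) (z • v), Lp.coeFn_smul ((2 * π) ^ 2 : ℂ) k,
      Lp.coeFn_smul z v] with x h1 h2 h3 h4 h5
    rw [h2, Pi.smul_apply, h3, Pi.sub_apply, h4, h5, Pi.smul_apply, Pi.smul_apply, ← h1]
    simp only [smul_eq_mul]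
    ring
  rw [← norm_eq_zero, ← Lp.norm_fourier_eq (u : L2R), ← hv, hv0, norm_zero]

/-- A right inverse of an injective operator is also a left inverse. -/
theorem isResolventAt_airyResolvent (z : ℂ) : IsResolventAt airyOp z (airyResolvent z) := by
  refine ⟨airyOp_airyResolvent z, fun u => ?_⟩
  obtain ⟨h, he⟩ := airyOp_airyResolvent z (airyOp u - z • (u : L2R))
  have h0 := eq_zero_of_airyOp_eq_smul (z := z) (⟨_, h⟩ - u) (by
    rw [LinearPMap.map_sub, Submodule.coe_sub, smul_sub]
    rw [← sub_eq_zero] at he ⊢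
    rw [← he]
    abel)
  rwa [Submodule.coe_sub, sub_eq_zero] at h0

end

end

open Real in
theorem mainTheorem4 :
    ∃ M C : ℝ, 0 < M ∧ 0 < C ∧ ∀ z : ℂ, M ≤ z.re →
      ∃ R : L2R →L[ℂ] L2R, IsResolventAt airyOp z R ∧
        ∃ ε₁ ε₂ : ℝ,
          |ε₁| ≤ C * z.re ^ (-(3 / 2) : ℝ) ∧
          |ε₂| ≤ C * z.re ^ (-(1 / 4) : ℝ) ∧
          ‖R‖ = Real.sqrt (Real.pi / 2) * z.re ^ (-(1 / 4) : ℝ) * (1 + ε₁) *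
              Real.exp (4 / 3 * z.re ^ (3 / 2 : ℝ)) + ε₂ := by
  have hJ := gaussianSixthMoment_nonneg
  have hs : 0 < √(π / 2) := by positivity
  -- `16 = 2⁴` ensures `c = (Re z)^{1/4} ≥ 2`; the second constant is the error coefficient relative
  -- to the main term.
  refine ⟨16, (2 * gaussianSixthMoment + 18) / √(π / 2), by norm_num, by positivity,
    fun z hz => ⟨airyResolvent z, isResolventAt_airyResolvent z, ?_⟩⟩
  have hz0 : 0 < z.re := by linarith
  set c := z.re ^ (1 / 4 : ℝ) with hc
  have hc0 : 0 < c := rpow_pos_of_pos hz0 _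
  have hc2 : 2 ≤ c := by
    have h16 : (16 : ℝ) ^ (1 / 4 : ℝ) = 2 := by
      rw [show (16 : ℝ) = 2 ^ (4 : ℝ) by norm_num, ← rpow_mul (by norm_num)]
      norm_num
    rw [← h16]
    exact rpow_le_rpow (by norm_num) hz (by norm_num)
  have e4 : z.re = c ^ 4 := by
    rw [hc, ← rpow_mul_natCast hz0.le]
    norm_num
  have e6 : z.re ^ (3 / 2 : ℝ) = c ^ 6 := by
    rw [hc, ← rpow_mul_natCast hz0.le]
    norm_num
  have e6' : z.re ^ (-(3 / 2) : ℝ) = (c ^ 6)⁻¹ := by rw [rpow_neg hz0.le, e6]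
  have e1 : z.re ^ (-(1 / 4) : ℝ) = c⁻¹ := by rw [rpow_neg hz0.le, hc]
  have hmain := abs_norm_airyFourierResolvent_sub_main_le hc2 e4
  rw [← norm_airyResolvent] at hmain
  rw [e6, e6', e1]
  set m := exp (4 / 3 * c ^ 6) * (√(π / 2) / c) with hm
  have hm0 : 0 < m := by positivity
  -- The whole error fits in the relative term, so `ε₂ = 0`.
  refine ⟨‖airyResolvent z‖ / m - 1, 0, ?_, ?_, ?_⟩
  · rw [div_sub_one hm0.ne', abs_div, abs_of_pos hm0, div_le_iff₀ hm0]
    refine hmain.trans_eq ?_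
    rw [hm]
    field_simp
  · rw [abs_zero]
    positivity
  · rw [add_sub_cancel, add_zero]
    have : √(π / 2) * c⁻¹ * (‖airyResolvent z‖ / m) * exp (4 / 3 * c ^ 6) =
        m * (‖airyResolvent z‖ / m) := by
      rw [hm]
      ring
    rw [this, mul_div_cancel₀ _ hm0.ne']
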